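/- **Theorem (Euler–Poincaré reduction).** Let $G$ be a (finite-dimensional, smooth) Lie group with Lie algebra $\mathfrak g = T_eG$, whose bracket is that of left-invariant vector fields (the commutator, for matrix groups). Let $L : TG\to\mathbb R$ be a smooth right-invariant Lagrangian, i.e. $L(T_gR_h(v)) = L(v)$ for all $g,h\in G$ and $v\in T_gG$, where $R_h(g)=gh$, and let $l := L|_{\mathfrak g}:\mathfrak g\to\mathbb R$. Let $a<b$, let $g:[a,b]\to G$ be a $C^2$ curve, and put $$\xi(t) := \dot g(t)\, g(t)^{-1} := T_{g(t)}R_{g(t)^{-1}}\,\dot g(t)\in\mathfrak g ,\qquad t\in[a,b].$$ Then the following four statements are equivalent. 1. $g$ satisfies the Euler–Lagrange equations for $L$ on $[a,b]$: in every smooth chart of $G$, with coordinates $q$ and induced coordinates $(q,\dot q)$ on $TG$, one has $\frac{d}{dt}\frac{\partial L}{\partial \dot q}(q(t),\dot q(t)) = \frac{\partial L}{\partial q}(q(t),\dot q(t))$ at every $t\in[a,b]$ for which $g(t)$ lies in the chart domain. 2. Hamilton's principle $\delta\int_a^b L(g(t),\dot g(t))\,dt = 0$ holds for variations with fixed endpoints: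 for every $\varepsilon>0$ and every $C^2$ family $g(t,s)\in G$, $(t,s)\in[a,b]\times(-\varepsilon,\varepsilon)$, with $g(t,0)=g(t)$, $g(a,s)=g(a)$ and $g(b,s)=g(b)$ for all $t$ and $s$, the derivative $\frac{d}{ds}\big|_{s=0}\int_a^b L\big(g(t,s),\partial_t g(t,s)\big)\,dt$ exists and equals $0$. 3. The (right-invariant) Euler–Poincaré equations hold on $[a,b]$: $$\frac{d}{dt}\frac{\delta l}{\delta\xi} = -\,\mathrm{ad}^*_{\xi}\,\frac{\delta l}{\delta\xi},$$ where $\frac{\delta l}{\delta\xi}(t)\in\mathfrak g^*$ is the differential of $l$ at $\xi(t)$ and $\langle \mathrm{ad}^*_\xi\mu,\eta\rangle = \langle\mu,[\xi,\eta]\rangle$. 4. The reduced variational principle $\delta\int_a^b l(\xi(t))\,dt = 0$ holds on $\mathfrak g$ for variations of the form $\delta\xi = \dot\eta-[\xi,\eta]$: for every $C^1$ path $\eta:[a,b]\to\mathfrak g$ with $\eta(a)=\eta(b)=0$, every $\varepsilon>0$ and every continuous family $\xi(t,s)\in\mathfrak g$, $(t,s)\in[a,b]\times(-\varepsilon,\varepsilon)$,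 for which $\partial_s\xi(t,s)$ exists and is continuous in $(t,s)$, with $\xi(t,0)=\xi(t)$ and $\partial_s\xi(t,0) = \dot\eta(t)-[\xi(t),\eta(t)]$ for all $t\in[a,b]$, the derivative $\frac{d}{ds}\big|_{s=0}\int_a^b l(\xi(t,s))\,dt$ exists and equals $0$. (At $t=a,b$, derivatives in $t$ are one-sided.) -/

import Mathlib

open Set
open scoped Manifold ContDiff

noncomputable section

namespace EulerPoincare

section Curves

variable {E : Type*} [NormedAddCommGroup E] [NormedSpace ℝ E]
  {H : Type*} [TopologicalSpace H] (I : ModelWithCorners ℝ E H)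
  {G : Type*} [TopologicalSpace G] [ChartedSpace H G]

/-- The velocity `ċ(t) ∈ T_{c(t)} G` of a curve `c` on `[a, b]` (one-sided at the endpoints). -/
def velocity (a b : ℝ) (c : ℝ → G) (t : ℝ) : TangentSpace I (c t) :=
  mfderivWithin 𝓘(ℝ, ℝ) I c (Icc a b) t (1 : ℝ)

/-- The action `∫ₐᵇ L(c(t), ċ(t)) dt`. -/
def action (L : TangentBundle I G → ℝ) (a b : ℝ) (c : ℝ → G) : ℝ :=
  ∫ t in a..b, L ⟨c t, velocity I a b c t⟩

/-- The Lagrangian `L(q, v)` in the local coordinates of the chart `e`: a coordinate pair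
`(q, v) ∈ E × E` stands for the tangent vector `D(φ⁻¹)(q) v` at `φ⁻¹(q)`, `φ` being the
coordinate map of `e`. -/
def localLagrangian (L : TangentBundle I G → ℝ) (e : OpenPartialHomeomorph G H) (q v : E) : ℝ :=
  L ⟨(e.extend I).symm q, mfderiv 𝓘(ℝ, E) I (e.extend I).symm q v⟩

/-- The Euler–Lagrange equations on `[a, b]`: in every smooth local chart of `G`, the coordinate
expression `q(t)` of the curve satisfies `d/dt (∂L/∂q̇)(q, q̇) = (∂L/∂q)(q, q̇)`, as an equation
in the dual of the coordinate space, at every time at which the curve is in the chart domain. -/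
def EulerLagrange (L : TangentBundle I G → ℝ) (a b : ℝ) (g : ℝ → G) : Prop :=
  ∀ e ∈ IsManifold.maximalAtlas I ∞ G, ∀ t ∈ Icc a b, g t ∈ e.source →
    let q : ℝ → E := fun τ => e.extend I (g τ)
    let q' : ℝ → E := derivWithin q (Icc a b)
    HasDerivWithinAt
      (fun τ => fderiv ℝ (fun v => localLagrangian I L e (q τ) v) (q' τ))
      (fderiv ℝ (fun x => localLagrangian I L e x (q' t)) (q t))
      (Icc a b) t

/-- A `C²` family of curves `c(t, s)`, `t ∈ [a, b]`, `|s| < ε`, with `c(t, 0) = g(t)` and with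
fixed endpoints. -/
structure IsDeformation (a b : ℝ) (g : ℝ → G) (ε : ℝ) (c : ℝ → ℝ → G) : Prop where
  contMDiffOn : ContMDiffOn 𝓘(ℝ, ℝ × ℝ) I 2 (fun p : ℝ × ℝ => c p.1 p.2)
    (Icc a b ×ˢ Ioo (-ε) ε)
  at_zero : ∀ t ∈ Icc a b, c t 0 = g t
  left_endpoint : ∀ s ∈ Ioo (-ε) ε, c a s = g a
  right_endpoint : ∀ s ∈ Ioo (-ε) ε, c b s = g b

/-- Hamilton's principle `δ ∫ₐᵇ L(g, ġ) dt = 0` for variations with fixed endpoints. -/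
def HamiltonPrinciple (L : TangentBundle I G → ℝ) (a b : ℝ) (g : ℝ → G) : Prop :=
  ∀ ε > 0, ∀ c : ℝ → ℝ → G, IsDeformation I a b g ε c →
    HasDerivAt (fun s => action I L a b (fun t => c t s)) 0 0

end Curves

section Group

variable {E : Type*} [NormedAddCommGroup E] [NormedSpace ℝ E]
  {H : Type*} [TopologicalSpace H] (I : ModelWithCorners ℝ E H)
  {G : Type*} [TopologicalSpace G] [ChartedSpace H G] [Group G]

/-- Right invariance `L(T_g R_h (v)) = L(v)` of a Lagrangian. -/
def IsRightInvariant (L : TangentBundle I G → ℝ) : Prop :=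
  ∀ (g h : G) (v : TangentSpace I g), L ⟨g * h, mfderiv I I (fun x => x * h) g v⟩ = L ⟨g, v⟩

/-- The restriction `l` of a Lagrangian to the Lie algebra `𝔤 = T_e G`. -/
def reducedLagrangian (L : TangentBundle I G → ℝ) (ξ : GroupLieAlgebra I G) : ℝ :=
  L ⟨1, ξ⟩

/-- `v ↦ v · g⁻¹ = T_g R_{g⁻¹} v`, from `T_g G` to `𝔤`. The derivative takes its values in the
tangent space at `g * g⁻¹`, which is the one at `1` (both are the model space `E`, identified
with the tangent space through the preferred chart at the point). -/
def rightTranslateToLieAlgebra (g : G) (v : TangentSpace I g) : GroupLieAlgebra I G :=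
  (mfderiv I I (fun x => x * g⁻¹) g v : TangentSpace I (g * g⁻¹))

/-- `ξ(t) = ġ(t) · g(t)⁻¹`. -/
def reducedVelocity (a b : ℝ) (g : ℝ → G) (t : ℝ) : GroupLieAlgebra I G :=
  rightTranslateToLieAlgebra I (g t) (velocity I a b g t)

variable (G)

theorem lieGroup_minSmoothness [LieGroup I ∞ G] : LieGroup I (minSmoothness ℝ 3) G := by
  rw [minSmoothness_of_isRCLikeNormedField]
  infer_instance

theorem finiteDimensional_lieAlgebra [FiniteDimensional ℝ E] :
    FiniteDimensional ℝ (GroupLieAlgebra I G) :=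
  inferInstanceAs (FiniteDimensional ℝ E)

theorem t2Space_lieAlgebra : T2Space (GroupLieAlgebra I G) :=
  inferInstanceAs (T2Space E)

variable {G}

/-- The adjoint operator `ad_ξ η = [ξ, η]` on `𝔤`. -/
def adjointOp [FiniteDimensional ℝ E] [LieGroup I ∞ G] (ξ : GroupLieAlgebra I G) :
    GroupLieAlgebra I G →L[ℝ] GroupLieAlgebra I G :=
  haveI := lieGroup_minSmoothness I G
  haveI : CompleteSpace E := FiniteDimensional.complete ℝ E
  haveI := finiteDimensional_lieAlgebra I G
  haveI := t2Space_lieAlgebra I G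
  LinearMap.toContinuousLinearMap
    (LieAlgebra.ad ℝ (GroupLieAlgebra I G) ξ : GroupLieAlgebra I G →ₗ[ℝ] GroupLieAlgebra I G)

theorem adjointOp_apply [FiniteDimensional ℝ E] [LieGroup I ∞ G] (ξ η : GroupLieAlgebra I G) :
    adjointOp I ξ η = ⁅ξ, η⁆ :=
  rfl

/-- The coadjoint operator on `𝔤*`, `⟨ad*_ξ μ, η⟩ = ⟨μ, ad_ξ η⟩`. -/
def coadjointOp [FiniteDimensional ℝ E] [LieGroup I ∞ G] (ξ : GroupLieAlgebra I G)
    (μ : GroupLieAlgebra I G →L[ℝ] ℝ) : GroupLieAlgebra I G →L[ℝ] ℝ :=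
  μ.comp (adjointOp I ξ)

/-- The Euler–Poincaré equations `d/dt δl/δξ = - ad*_ξ δl/δξ` on `[a, b]`, where
`δl/δξ ∈ 𝔤*` is the differential of `l` at `ξ`. -/
def EulerPoincareEquations [FiniteDimensional ℝ E] [LieGroup I ∞ G]
    (l : GroupLieAlgebra I G → ℝ) (a b : ℝ) (ξ : ℝ → GroupLieAlgebra I G) : Prop :=
  ∀ t ∈ Icc a b,
    HasDerivWithinAt (fun τ => fderiv ℝ l (ξ τ)) (-coadjointOp I (ξ t) (fderiv ℝ l (ξ t)))
      (Icc a b) t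

/-- A family of curves `Ξ(t, s)`, `t ∈ [a, b]`, `|s| < ε`, in `𝔤`, continuous and continuously
differentiable in `s`, with `Ξ(t, 0) = ξ(t)` and
`δξ(t) := ∂Ξ/∂s (t, 0) = η̇(t) - [ξ(t), η(t)]`. -/
structure IsConstrainedVariation (a b : ℝ) (ξ η : ℝ → GroupLieAlgebra I G) (ε : ℝ)
    (Ξ : ℝ → ℝ → GroupLieAlgebra I G) : Prop where
  continuousOn : ContinuousOn (fun p : ℝ × ℝ => Ξ p.1 p.2) (Icc a b ×ˢ Ioo (-ε) ε)
  differentiableAt : ∀ t ∈ Icc a b, ∀ s ∈ Ioo (-ε) ε, DifferentiableAt ℝ (Ξ t) s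
  continuousOn_deriv : ContinuousOn (fun p : ℝ × ℝ => deriv (Ξ p.1) p.2)
    (Icc a b ×ˢ Ioo (-ε) ε)
  at_zero : ∀ t ∈ Icc a b, Ξ t 0 = ξ t
  variation : ∀ t ∈ Icc a b, deriv (Ξ t) 0 = derivWithin η (Icc a b) t - ⁅ξ t, η t⁆

/-- The reduced variational principle `δ ∫ₐᵇ l(ξ) dt = 0` for variations of the form
`δξ = η̇ - [ξ, η]`, where `η` is an arbitrary `C¹` path in `𝔤` on `[a, b]` with
`η(a) = η(b) = 0`. -/
def ReducedPrinciple (l : GroupLieAlgebra I G → ℝ) (a b : ℝ)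
    (ξ : ℝ → GroupLieAlgebra I G) : Prop :=
  ∀ η : ℝ → GroupLieAlgebra I G, DifferentiableOn ℝ η (Icc a b) →
    ContinuousOn (derivWithin η (Icc a b)) (Icc a b) → η a = 0 → η b = 0 →
    ∀ ε > 0, ∀ Ξ : ℝ → ℝ → GroupLieAlgebra I G, IsConstrainedVariation I a b ξ η ε Ξ →
      HasDerivAt (fun s => ∫ t in a..b, l (Ξ t s)) 0 0

end Group

end EulerPoincare

end

/-! Everything rests on the Maurer–Cartan equation. For a C² map c from a normed space into G, the
right logarithmic derivative Θ = (Dc) c⁻¹ is C¹ and satisfies DΘ(v)w − DΘ(w)v = [Θv, Θw]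
(`maurerCartan_rightLogDeriv`).

To prove it, read the division x y⁻¹ in a chart at the unit as M(x, y). Near a point, Θ = D₁M(u, u)
Du with u the coordinates of c c(x₀)⁻¹. The terms in D²u cancel by symmetry, and what remains is an
antisymmetrized mixed second derivative of M. The same expression is the bracket of left-invariant
fields (`bracket_eq_divisionBracket`).

With c an inverse chart and A its logarithmic derivative, invariance gives L(q, v) = l(A(q)v). Put μ
= dl(ξ). The Euler–Lagrange equation says μ̇(Aw) + μ(DA(q̇)w − DA(w)q̇) = 0 for all w. By
Maurer–Cartan this is μ̇(Aw) = −μ([ξ, Aw]), and A is surjective, so it is the Euler–Poincaré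
equation (1 ↔ 3).

With c a deformation c(t, s), ξ and η the components of Θ along t and s, the same equation reads ∂ₛξ
= η̇ − [ξ, η] at s = 0, so deformations induce constrained variations (4 → 2). Euler–Poincaré makes
μ(η) an antiderivative of μ(η̇ − [ξ, η]), and η vanishes at the endpoints (3 → 4). Conversely every
smooth η vanishing at the endpoints comes from a deformation (`exists_isDeformation`), and the
fundamental lemma of the calculus of variations applies (2 → 3). -/

noncomputable section

namespace EulerPoincare

open Filter MeasureTheory
open scoped Topology

/-! ### Calculus of variations in a normed space, with an abstract bracket -/

section Calculus

variable {V : Type*} [NormedAddCommGroup V] [NormedSpace ℝ V]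

/-- Differentiation under the integral sign for a functional `∫ l(X(t, s)) dt`. -/
theorem hasDerivAt_integral_comp {l : V → ℝ} (hl : ContDiff ℝ 1 l) {a b ε : ℝ} (hab : a ≤ b)
    (hε : 0 < ε) {X : ℝ → ℝ → V}
    (hX : ContinuousOn (fun p : ℝ × ℝ => X p.1 p.2) (Icc a b ×ˢ Ioo (-ε) ε))
    (hd : ∀ t ∈ Icc a b, ∀ s ∈ Ioo (-ε) ε, DifferentiableAt ℝ (X t) s)
    (hX' : ContinuousOn (fun p : ℝ × ℝ => deriv (X p.1) p.2) (Icc a b ×ˢ Ioo (-ε) ε)) :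
    HasDerivAt (fun s => ∫ t in a..b, l (X t s))
      (∫ t in a..b, fderiv ℝ l (X t 0) (deriv (X t) 0)) 0 := by
  have hl' : Continuous (fderiv ℝ l) := hl.continuous_fderiv one_ne_zero
  have hF' : ContinuousOn (fun p : ℝ × ℝ => fderiv ℝ l (X p.1 p.2) (deriv (X p.1) p.2))
      (Icc a b ×ˢ Ioo (-ε) ε) := (hl'.comp_continuousOn hX).clm_apply hX'
  have hline : ∀ s ∈ Ioo (-ε) ε, ContinuousOn (fun t : ℝ => (t, s)) (Icc a b) ∧
      MapsTo (fun t : ℝ => (t, s)) (Icc a b) (Icc a b ×ˢ Ioo (-ε) ε) := fun s hs =>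
    ⟨by fun_prop, fun t ht => ⟨ht, hs⟩⟩
  have h0 : (0 : ℝ) ∈ Ioo (-ε) ε := ⟨by linarith, hε⟩
  have hcF : ∀ s ∈ Ioo (-ε) ε, ContinuousOn (fun t => l (X t s)) (Icc a b) := fun s hs =>
    hl.continuous.comp_continuousOn (hX.comp (hline s hs).1 (hline s hs).2)
  have hcF' : ContinuousOn (fun t => fderiv ℝ l (X t 0) (deriv (X t) 0)) (Icc a b) :=
    hF'.comp (hline 0 h0).1 (hline 0 h0).2
  -- Halving ε yields a compact strip, where the continuous s-derivative has the uniform bound that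
  -- domination requires.
  have hsub : Icc a b ×ˢ Icc (-(ε / 2)) (ε / 2) ⊆ Icc a b ×ˢ Ioo (-ε) ε :=
    prod_mono_right fun s hs => ⟨by linarith [hs.1], by linarith [hs.2]⟩
  obtain ⟨C, hC⟩ := (isCompact_Icc.prod isCompact_Icc).exists_bound_of_continuousOn
    (hF'.mono hsub)
  have hI : uIoc a b ⊆ Icc a b := by rw [uIoc_of_le hab]; exact Ioc_subset_Icc_self
  refine (intervalIntegral.hasDerivAt_integral_of_dominated_loc_of_deriv_le
    (F := fun s t => l (X t s)) (F' := fun s t => fderiv ℝ l (X t s) (deriv (X t) s))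
    (bound := fun _ => C) (s := Icc (-(ε / 2)) (ε / 2))
    (Icc_mem_nhds (by linarith) (by linarith)) ?_ ?_ ?_ ?_ ?_ ?_).2
  · filter_upwards [Ioo_mem_nhds h0.1 h0.2] with s hs
    exact ((hcF s hs).mono hI).aestronglyMeasurable measurableSet_uIoc
  · exact ContinuousOn.intervalIntegrable (by rw [uIcc_of_le hab]; exact hcF 0 h0)
  · exact (hcF'.mono hI).aestronglyMeasurable measurableSet_uIoc
  · exact Eventually.of_forall fun t ht s hs => hC (t, s) ⟨hI ht, hs⟩
  · exact intervalIntegrable_const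
  · refine Eventually.of_forall fun t ht s hs => ?_
    have hs' := (hsub (show (t, s) ∈ _ from ⟨hI ht, hs⟩)).2
    exact ((hl.differentiable one_ne_zero _).hasFDerivAt).comp_hasDerivAt s
      (hd t (hI ht) s hs').hasDerivAt

/-- Integration by parts: a momentum solving `μ̇ = -μ ∘ ad_ξ` annihilates all `η̇ - [ξ, η]` with
`η` vanishing at the end points. -/
theorem integral_eq_zero_of_hasDerivWithinAt {a b : ℝ} (hab : a ≤ b) {μ : ℝ → V →L[ℝ] ℝ}
    {B : V →L[ℝ] V →L[ℝ] V} {ξ η : ℝ → V} (hξ : ContinuousOn ξ (Icc a b))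
    (hμ : ∀ t ∈ Icc a b, HasDerivWithinAt μ (-((μ t).comp (B (ξ t)))) (Icc a b) t)
    (hη : DifferentiableOn ℝ η (Icc a b))
    (hη' : ContinuousOn (derivWithin η (Icc a b)) (Icc a b)) (ha : η a = 0) (hb : η b = 0) :
    ∫ t in a..b, μ t (derivWithin η (Icc a b) t - B (ξ t) (η t)) = 0 := by
  have hμc : ContinuousOn μ (Icc a b) := fun t ht => (hμ t ht).continuousWithinAt
  have hf : ∀ t ∈ Icc a b, HasDerivWithinAt (fun t => μ t (η t))
      (μ t (derivWithin η (Icc a b) t - B (ξ t) (η t))) (Icc a b) t := by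
    intro t ht
    refine ((hμ t ht).clm_apply (hη t ht).hasDerivWithinAt).congr_deriv ?_
    simp [sub_eq_add_neg, add_comm]
  rw [intervalIntegral.integral_eq_sub_of_hasDerivAt_of_le hab
    (f := fun t => μ t (η t)) (fun t ht => (hf t ht).continuousWithinAt)
    (fun t ht => (hf t (Ioo_subset_Icc_self ht)).hasDerivAt (Icc_mem_nhds ht.1 ht.2))]
  · simp [ha, hb]
  · apply ContinuousOn.intervalIntegrable
    rw [uIcc_of_le hab]
    have : ContinuousOn (fun t => B (ξ t) (η t)) (Icc a b) :=
      (B.continuous.comp_continuousOn hξ).clm_apply hη.continuousOn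
    exact hμc.clm_apply (hη'.sub this)

/-- The fundamental lemma of the calculus of variations for variations `η̇ - [ξ, η]`. -/
theorem eq_of_integral_eq_zero {a b : ℝ} (hab : a < b) {μ μ' : ℝ → V →L[ℝ] ℝ}
    {B : V →L[ℝ] V →L[ℝ] V} {ξ : ℝ → V} (hξ : ContinuousOn ξ (Icc a b))
    (hμ : ∀ t ∈ Icc a b, HasDerivWithinAt μ (μ' t) (Icc a b) t)
    (hμ' : ContinuousOn μ' (Icc a b))
    (h : ∀ η : ℝ → V, ContDiff ℝ ∞ η → HasCompactSupport η → tsupport η ⊆ Ioo a b →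
      ∫ t in a..b, μ t (deriv η t - B (ξ t) (η t)) = 0) :
    ∀ t ∈ Icc a b, μ' t = -((μ t).comp (B (ξ t))) := by
  have hμc : ContinuousOn μ (Icc a b) := fun t ht => (hμ t ht).continuousWithinAt
  have hBξ : ContinuousOn (fun t => B (ξ t)) (Icc a b) := B.continuous.comp_continuousOn hξ
  -- Test fields ρ(t)w with w fixed reduce the claim to the scalar fundamental lemma.
  have key : ∀ w : V, ∀ t ∈ Icc a b, (μ' t + (μ t).comp (B (ξ t))) w = 0 := by
    intro w
    set f : ℝ → ℝ := fun t => (μ' t + (μ t).comp (B (ξ t))) w with hf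
    have hfc : ContinuousOn f (Icc a b) :=
      (hμ'.add (hμc.clm_comp hBξ)).clm_apply continuousOn_const
    have hae : ∀ᵐ t, t ∈ Ioo a b → f t = 0 := by
      refine isOpen_Ioo.ae_eq_zero_of_integral_contDiff_smul_eq_zero
        ((hfc.mono Ioo_subset_Icc_self).locallyIntegrableOn measurableSet_Ioo) ?_
      intro ρ hρ hρc hρs
      have hz : ∀ t ∉ Ioo a b, ρ t = 0 := fun t ht =>
        image_eq_zero_of_notMem_tsupport fun h' => ht (hρs h')
      have hρd : ∀ t, HasDerivAt ρ (deriv ρ t) t := fun t =>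
        (hρ.differentiable (by simp) t).hasDerivAt
      have hd : ∀ t, deriv (fun t => ρ t • w) t = deriv ρ t • w := fun t =>
        ((hρd t).smul_const w).deriv
      have hw := h (fun t => ρ t • w) (hρ.smul contDiff_const) (hρc.smul_right)
        ((closure_mono (by intro t ht h0; simp [h0] at ht)).trans hρs)
      have hρ' : Continuous (deriv ρ) := hρ.continuous_deriv (by simp)
      have hparts : ∫ t in a..b, (μ t (deriv ρ t • w) + μ' t (ρ t • w)) = 0 := by
        rw [intervalIntegral.integral_eq_sub_of_hasDerivAt_of_le hab.le
          (f := fun t => μ t (ρ t • w))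
          (hμc.clm_apply (hρ.continuous.smul continuous_const).continuousOn)
          (fun t ht => ?deriv) ?integrable]
        · simp [hz a (by simp), hz b (by simp)]
        case deriv =>
          have := ((hμ t (Ioo_subset_Icc_self ht)).hasDerivAt
            (Icc_mem_nhds ht.1 ht.2)).clm_apply ((hρd t).smul_const w)
          rwa [add_comm] at this
        case integrable =>
          apply ContinuousOn.intervalIntegrable
          rw [uIcc_of_le hab.le]
          exact (hμc.clm_apply (hρ'.smul continuous_const).continuousOn).add
            (hμ'.clm_apply (hρ.continuous.smul continuous_const).continuousOn)
      -- The integrand ρf is the total derivative of μ(ρw) minus the tested integrand; both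
      -- integrate to zero.
      have hfi : ∫ t in a..b, ρ t • f t = 0 := by
        rw [← sub_zero (0 : ℝ)]
        nth_rewrite 2 [← hw]
        rw [← hparts, ← intervalIntegral.integral_sub]
        · congr 1
          ext t
          simp only [hd]
          simp [hf]
          ring
        · apply ContinuousOn.intervalIntegrable
          rw [uIcc_of_le hab.le]
          exact (hμc.clm_apply (hρ'.smul continuous_const).continuousOn).add
            (hμ'.clm_apply (hρ.continuous.smul continuous_const).continuousOn)
        · apply ContinuousOn.intervalIntegrable
          rw [uIcc_of_le hab.le]
          simp only [hd]
          exact hμc.clm_apply ((hρ'.smul continuous_const).continuousOn.sub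
            (hBξ.clm_apply (hρ.continuous.smul continuous_const).continuousOn))
      rw [← hfi, intervalIntegral.integral_of_le hab.le]
      refine (setIntegral_eq_integral_of_forall_compl_eq_zero fun t ht => ?_).symm
      rw [hz t (fun h' => ht (Ioo_subset_Ioc_self h')), zero_smul]
    have hIoo : EqOn f 0 (Ioo a b) :=
      Measure.eqOn_open_of_ae_eq (μ := volume) (U := Ioo a b)
        ((ae_restrict_iff' measurableSet_Ioo).2 hae) isOpen_Ioo
        (hfc.mono Ioo_subset_Icc_self) continuousOn_const
    have := hIoo.of_subset_closure hfc continuousOn_const Ioo_subset_Icc_self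
      (by rw [closure_Ioo hab.ne])
    exact fun t ht => this ht
  intro t ht
  ext w
  have := key w t ht
  simp only [add_apply] at this
  simpa using eq_neg_of_add_eq_zero_left this

/-- For a Lagrangian of the form `l(A(q) v)`, the Euler–Lagrange equation is the
Euler–Poincaré equation, provided `A` satisfies the Maurer–Cartan equation. -/
theorem hasDerivWithinAt_fderiv_iff {l : V → ℝ} (hl : ContDiff ℝ 2 l) {A : V → V →L[ℝ] V}
    {F : V → V → ℝ} {B : V → V → V} {q q' ξ : ℝ → V} {q'' : V} {S : Set ℝ} {t : ℝ} (htS : t ∈ S)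
    (hS : UniqueDiffWithinAt ℝ S t)
    (hq : HasDerivWithinAt q (q' t) S t) (hq' : HasDerivWithinAt q' q'' S t)
    (hF : ∀ᶠ x in 𝓝 (q t), ∀ v, F x v = l (A x v)) (hA : DifferentiableAt ℝ A (q t))
    (hMC : ∀ v w, fderiv ℝ A (q t) v w - fderiv ℝ A (q t) w v = B (A (q t) v) (A (q t) w))
    (hsurj : Function.Surjective (A (q t))) (hξ : ∀ᶠ τ in 𝓝[S] t, ξ τ = A (q τ) (q' τ))
    {c : V →L[ℝ] ℝ} (hc : ∀ w, c w = fderiv ℝ l (ξ t) (B (ξ t) w)) :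
    HasDerivWithinAt (fun τ => fderiv ℝ (fun v => F (q τ) v) (q' τ))
      (fderiv ℝ (fun x => F x (q' t)) (q t)) S t ↔
    HasDerivWithinAt (fun τ => fderiv ℝ l (ξ τ)) (-c) S t := by
  have hξt : ξ t = A (q t) (q' t) := hξ.self_of_nhdsWithin htS
  have hdl : Differentiable ℝ l := hl.differentiable (by simp)
  have hddl : Differentiable ℝ (fderiv ℝ l) :=
    (hl.fderiv_right (m := 1) (by norm_num)).differentiable (by simp)
  have hAq : HasDerivWithinAt (fun τ => A (q τ)) (fderiv ℝ A (q t) (q' t)) S t :=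
    hA.hasFDerivAt.comp_hasDerivWithinAt t hq
  -- The momentum is differentiable whether or not either equation holds, so both sides of the
  -- equivalence become algebraic conditions on μ'.
  obtain ⟨μ', hμ⟩ : ∃ μ', HasDerivWithinAt (fun τ => fderiv ℝ l (ξ τ)) μ' S t := by
    have h1 : HasDerivWithinAt ξ (fderiv ℝ A (q t) (q' t) (q' t) + A (q t) q'') S t :=
      (hAq.clm_apply hq').congr_of_eventuallyEq hξ hξt
    exact ⟨_, (hddl _).hasFDerivAt.comp_hasDerivWithinAt t h1⟩
  have hlhs : HasDerivWithinAt (fun τ => fderiv ℝ (fun v => F (q τ) v) (q' τ))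
      (μ'.comp (A (q t)) + (fderiv ℝ l (ξ t)).comp (fderiv ℝ A (q t) (q' t))) S t := by
    refine (hμ.clm_comp hAq).congr_of_eventuallyEq_of_mem ?_ htS
    filter_upwards [hξ, hq.continuousWithinAt.eventually hF] with τ h1 h2
    rw [funext h2, h1]
    exact ((hdl _).hasFDerivAt.comp _ (A (q τ)).hasFDerivAt).fderiv
  have hrhs : fderiv ℝ (fun x => F x (q' t)) (q t) =
      (fderiv ℝ l (ξ t)).comp ((fderiv ℝ A (q t)).flip (q' t)) := by
    have hF' : (fun x => F x (q' t)) =ᶠ[𝓝 (q t)] fun x => l (A x (q' t)) :=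
      hF.mono fun x hx => hx (q' t)
    rw [hF'.fderiv_eq, hξt]
    exact ((hdl _).hasFDerivAt.comp _
      (hA.hasFDerivAt.clm_apply (hasFDerivAt_const _ _))).fderiv.trans (by ext; simp)
  rw [hrhs]
  have h1 : ∀ {ν : V →L[ℝ] ℝ}, HasDerivWithinAt (fun τ => fderiv ℝ l (ξ τ)) ν S t ↔ μ' = ν :=
    ⟨fun h => hS.eq_deriv _ hμ h, fun h => h ▸ hμ⟩
  have h2 : ∀ {ν : V →L[ℝ] ℝ}, HasDerivWithinAt
      (fun τ => fderiv ℝ (fun v => F (q τ) v) (q' τ)) ν S t ↔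
      μ'.comp (A (q t)) + (fderiv ℝ l (ξ t)).comp (fderiv ℝ A (q t) (q' t)) = ν :=
    ⟨fun h => hS.eq_deriv _ hlhs h, fun h => h ▸ hlhs⟩
  rw [h1, h2]
  have h3 : ∀ w, fderiv ℝ l (ξ t) (fderiv ℝ A (q t) (q' t) w) -
      fderiv ℝ l (ξ t) (fderiv ℝ A (q t) w (q' t)) = c (A (q t) w) := fun w => by
    rw [← map_sub, hMC, hc, hξt]
  constructor
  · intro h
    ext w
    obtain ⟨w, rfl⟩ := hsurj w
    have := congrArg (fun m => m w) h
    simp only [add_apply, ContinuousLinearMap.comp_apply,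
      ContinuousLinearMap.flip_apply] at this
    simp only [neg_apply]
    linarith [h3 w]
  · rintro rfl
    ext w
    simp only [add_apply, ContinuousLinearMap.comp_apply,
      ContinuousLinearMap.flip_apply, neg_apply]
    linarith [h3 w]

end Calculus

/-! ### Second-order calculus of a local division M(x, y) = x y⁻¹ -/

section Division

variable {V : Type*} [NormedAddCommGroup V] [NormedSpace ℝ V]
  {F : Type*} [NormedAddCommGroup F] [NormedSpace ℝ F]
  {M : V × V → V} {p : V}

/-- The bracket read off from the second derivative of a local division `M(x, y) = x y⁻¹` at the
unit `p`. -/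
def divisionBracket (M : V × V → V) (p : V) : V →L[ℝ] V →L[ℝ] V :=
  let T := (fderiv ℝ (fderiv ℝ M) (p, p)).bilinearComp (.inl ℝ V V) (.inr ℝ V V)
  T.flip - T

theorem divisionBracket_apply (v w : V) : divisionBracket M p v w =
    fderiv ℝ (fderiv ℝ M) (p, p) (w, 0) (0, v) - fderiv ℝ (fderiv ℝ M) (p, p) (v, 0) (0, w) := by
  simp [divisionBracket]

theorem eventually_hasFDerivAt (hM : ContDiffAt ℝ 2 M (p, p)) :
    ∀ᶠ z in 𝓝 (p, p), HasFDerivAt M (fderiv ℝ M z) z :=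
  (hM.eventually (by simp)).mono fun _ hz => (hz.differentiableAt (by simp)).hasFDerivAt

/-- The map M(·, p) is the identity near p. Having this on a neighbourhood, not just at p, allows a
second differentiation. -/
theorem fderiv_fst_of_right_unit (hM : ContDiffAt ℝ 2 M (p, p))
    (hr : ∀ᶠ y in 𝓝 p, M (y, p) = y) : ∀ᶠ x in 𝓝 p, ∀ w, fderiv ℝ M (x, p) (w, 0) = w := by
  have hc : Tendsto (fun x : V => (x, p)) (𝓝 p) (𝓝 (p, p)) :=
    (continuous_id.prodMk continuous_const).tendsto' _ _ rfl
  filter_upwards [hr.eventually_nhds, hc.eventually (eventually_hasFDerivAt hM)] with x hx hMx w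
  have h1 : HasFDerivAt (fun y => M (y, p)) _ x :=
    HasFDerivAt.comp x (g := M) (f := fun y => (y, p)) hMx
      ((hasFDerivAt_id x).prodMk (hasFDerivAt_const p x))
  have h2 := h1.unique ((hasFDerivAt_id x).congr_of_eventuallyEq hx)
  simpa using congrArg (fun m => m w) h2

theorem fderiv_fderiv_fst_fst (hM : ContDiffAt ℝ 2 M (p, p))
    (hr : ∀ᶠ y in 𝓝 p, M (y, p) = y) (v w : V) :
    fderiv ℝ (fderiv ℝ M) (p, p) (v, 0) (w, 0) = 0 := by
  have hd : DifferentiableAt ℝ (fderiv ℝ M) (p, p) :=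
    (hM.fderiv_right (m := 1) (by norm_num)).differentiableAt (by simp)
  have h1 : HasFDerivAt (fun x => fderiv ℝ M (x, p) (w, 0)) _ p :=
    (HasFDerivAt.comp p (g := fderiv ℝ M) (f := fun x => (x, p)) hd.hasFDerivAt
      ((hasFDerivAt_id p).prodMk (hasFDerivAt_const p p))).clm_apply
      (hasFDerivAt_const ((w, 0) : V × V) p)
  have h2 := h1.unique ((hasFDerivAt_const w p).congr_of_eventuallyEq
    ((fderiv_fst_of_right_unit hM hr).mono fun x hx => hx w))
  simpa using congrArg (fun m => m v) h2

/-- Differentiating M(z, z) = p along the diagonal gives D₁M v + D₂M v = 0, and D₁M is the identity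
at the unit. -/
theorem fderiv_snd_of_division (hM : ContDiffAt ℝ 2 M (p, p))
    (hr : ∀ᶠ y in 𝓝 p, M (y, p) = y) (hd : ∀ᶠ z in 𝓝 p, M (z, z) = p) (v : V) :
    fderiv ℝ M (p, p) (0, v) = -v := by
  have h1 : HasFDerivAt (fun z => M (z, z)) _ p :=
    HasFDerivAt.comp p (g := M) (f := fun z => (z, z)) (eventually_hasFDerivAt hM).self_of_nhds
      ((hasFDerivAt_id p).prodMk (hasFDerivAt_id p))
  have h2 := congrArg (fun m => m v) (h1.unique ((hasFDerivAt_const p p).congr_of_eventuallyEq hd))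
  have h3 := (fderiv_fst_of_right_unit hM hr).self_of_nhds v
  have h4 : fderiv ℝ M (p, p) (v, v) = 0 := by simpa using h2
  rw [show ((v, v) : V × V) = (v, 0) + (0, v) by simp, map_add, h3] at h4
  exact (neg_eq_of_add_eq_zero_right h4).symm

/-- The bracket at the unit of the fields `x ↦ -D₂M(x, p) v`, which are the left-invariant fields
if `M(x, y) = x y⁻¹`. -/
theorem lieBracket_neg_fderiv_snd (hM : ContDiffAt ℝ 2 M (p, p))
    (hr : ∀ᶠ y in 𝓝 p, M (y, p) = y) (hd : ∀ᶠ z in 𝓝 p, M (z, z) = p) (v w : V) :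
    VectorField.lieBracket ℝ (fun x => -fderiv ℝ M (x, p) (0, v))
      (fun x => -fderiv ℝ M (x, p) (0, w)) p = divisionBracket M p v w := by
  have hD : DifferentiableAt ℝ (fderiv ℝ M) (p, p) :=
    (hM.fderiv_right (m := 1) (by norm_num)).differentiableAt (by simp)
  have key : ∀ u : V, HasFDerivAt (fun x => -fderiv ℝ M (x, p) (0, u))
      (-((fderiv ℝ (fderiv ℝ M) (p, p)).comp (.inl ℝ V V)).flip (0, u)) p := by
    intro u
    have h1 : HasFDerivAt (fun x => fderiv ℝ M (x, p) (0, u)) _ p :=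
      (HasFDerivAt.comp p (g := fderiv ℝ M) (f := fun x => (x, p))
        hD.hasFDerivAt ((hasFDerivAt_id p).prodMk (hasFDerivAt_const p p))).clm_apply
        (hasFDerivAt_const ((0, u) : V × V) p)
    refine h1.neg.congr_fderiv ?_
    ext z
    simp
  simp only [VectorField.lieBracket_eq, (key v).fderiv, (key w).fderiv,
    fderiv_snd_of_division hM hr hd, neg_neg, divisionBracket_apply, neg_apply,
    ContinuousLinearMap.flip_apply, ContinuousLinearMap.comp_apply, ContinuousLinearMap.inl_apply]
  abel

/-- The Maurer–Cartan equation for `Θ = D₁M(u, u) ∘ Du`, the right logarithmic derivative of `u`. -/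
theorem maurerCartan_of_division (hM : ContDiffAt ℝ 2 M (p, p))
    (hr : ∀ᶠ y in 𝓝 p, M (y, p) = y) {u : F → V} {S : Set F} {x₀ : F} (hS : UniqueDiffOn ℝ S)
    (hx : x₀ ∈ S) (hx' : x₀ ∈ closure (interior S)) (hu : ContDiffWithinAt ℝ 2 u S x₀)
    (hup : u x₀ = p) {Θ : F → F →L[ℝ] V} (hΘ : ∀ᶠ x in 𝓝[S] x₀,
      Θ x = (fderiv ℝ M (u x, u x)).comp ((ContinuousLinearMap.inl ℝ V V).comp
        (fderivWithin ℝ u S x))) :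
    ContDiffWithinAt ℝ 1 Θ S x₀ ∧ ∀ v w, fderivWithin ℝ Θ S x₀ v w - fderivWithin ℝ Θ S x₀ w v =
      divisionBracket M p (Θ x₀ v) (Θ x₀ w) := by
  subst hup
  have hD : ContDiffAt ℝ 1 (fderiv ℝ M) (u x₀, u x₀) := hM.fderiv_right (by norm_num)
  have hu' : ContDiffWithinAt ℝ 1 (fderivWithin ℝ u S) S x₀ :=
    hu.fderivWithin_right hS (by norm_num) hx
  have hDu : ContDiffWithinAt ℝ 1 (fun x => fderiv ℝ M (u x, u x)) S x₀ :=
    hD.comp_contDiffWithinAt (f := fun x => (u x, u x)) x₀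
      ((hu.of_le (by norm_num)).prodMk (hu.of_le (by norm_num)))
  have hC : ContDiffWithinAt ℝ 1 (fun x => (fderiv ℝ M (u x, u x)).comp
      ((ContinuousLinearMap.inl ℝ V V).comp (fderivWithin ℝ u S x))) S x₀ :=
    hDu.clm_comp (contDiffWithinAt_const.clm_comp hu')
  have hΘ₀ := hΘ.self_of_nhdsWithin hx
  refine ⟨hC.congr_of_eventuallyEq hΘ hΘ₀, ?_⟩
  have hder : ∀ v w, fderivWithin ℝ Θ S x₀ v w =
      fderiv ℝ (fderiv ℝ M) (u x₀, u x₀) (fderivWithin ℝ u S x₀ v, fderivWithin ℝ u S x₀ v)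
        (fderivWithin ℝ u S x₀ w, 0) +
      fderiv ℝ M (u x₀, u x₀) (fderivWithin ℝ (fderivWithin ℝ u S) S x₀ v w, 0) := by
    intro v w
    have h1 : HasFDerivWithinAt u (fderivWithin ℝ u S x₀) S x₀ :=
      (hu.differentiableWithinAt (by simp)).hasFDerivWithinAt
    have h2 : HasFDerivWithinAt (fderivWithin ℝ u S) (fderivWithin ℝ (fderivWithin ℝ u S) S x₀)
        S x₀ := (hu'.differentiableWithinAt (by simp)).hasFDerivWithinAt
    have h3 : HasFDerivWithinAt (fun x => fderiv ℝ M (u x, u x)) _ S x₀ :=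
      HasFDerivAt.comp_hasFDerivWithinAt x₀ (g := fderiv ℝ M) (f := fun x => (u x, u x))
        (hD.differentiableAt (by simp)).hasFDerivAt (h1.prodMk h1)
    have h4 := h3.clm_apply (((ContinuousLinearMap.inl ℝ V V).hasFDerivAt.comp_hasFDerivWithinAt x₀
      (h2.clm_apply (hasFDerivWithinAt_const w x₀ S))))
    have h5 : HasFDerivWithinAt (fun x => Θ x w) _ S x₀ := h4.congr_of_eventuallyEq
      (hΘ.mono fun x hx => by simp [hx]) (by simp [hΘ₀])
    have h6 : HasFDerivWithinAt (fun x => Θ x w) _ S x₀ :=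
      (((hC.congr_of_eventuallyEq hΘ hΘ₀).differentiableWithinAt
        (by simp)).hasFDerivWithinAt).clm_apply (hasFDerivWithinAt_const w x₀ S)
    have h7 := congrArg (fun m => m v) ((hS x₀ hx).eq h6 h5)
    simpa [add_comm] using h7
  intro v w
  -- Symmetry of D²u within S is where `x₀ ∈ closure (interior S)` enters; it cancels the D²u terms.
  have hsu := hu.isSymmSndFDerivWithinAt (by simp) hS hx' hx v w
  have hsM := fun a b => (hM.isSymmSndFDerivAt (by simp)).eq a b
  have hΘa : ∀ a, Θ x₀ a = fderivWithin ℝ u S x₀ a := fun a => by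
    rw [hΘ₀]
    exact (fderiv_fst_of_right_unit hM hr).self_of_nhds _
  -- The pure second derivative in the first slot vanishes, so only the mixed one survives.
  have hsplit : ∀ a b : V, fderiv ℝ (fderiv ℝ M) (u x₀, u x₀) (a, a) (b, 0) =
      fderiv ℝ (fderiv ℝ M) (u x₀, u x₀) (b, 0) (0, a) := fun a b => by
    rw [hsM, show ((a, a) : V × V) = (a, 0) + (0, a) by simp, map_add,
      fderiv_fderiv_fst_fst hM hr, zero_add]
  rw [hder, hder, hsu, hΘa, hΘa, divisionBracket_apply, hsplit, hsplit]
  abel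

end Division

theorem two_le_infty : (2 : ℕ∞ω) ≤ ∞ := WithTop.coe_le_coe.2 (le_top : (2 : ℕ∞) ≤ ⊤)

/-! ### The right logarithmic derivative and the Maurer–Cartan equation -/

section LogarithmicDerivative

variable {E : Type*} [NormedAddCommGroup E] [NormedSpace ℝ E]
  {H : Type*} [TopologicalSpace H] (I : ModelWithCorners ℝ E H)
  {G : Type*} [TopologicalSpace G] [ChartedSpace H G] [Group G]
  {F : Type*} [NormedAddCommGroup F] [NormedSpace ℝ F]

variable (G) in
/-- The division `(x, y) ↦ x y⁻¹` in the preferred chart at the unit. -/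
def chartDivision (z : E × E) : E :=
  extChartAt I (1 : G) ((extChartAt I (1 : G)).symm z.1 * ((extChartAt I (1 : G)).symm z.2)⁻¹)

/-- The right logarithmic derivative `v ↦ (Dc(x) v) c(x)⁻¹` of `c`, within the set `S`. -/
def rightLogDeriv (c : F → G) (S : Set F) (x : F) : F →L[ℝ] E :=
  fderivWithin ℝ (fun y => extChartAt I (1 : G) (c y * (c x)⁻¹)) S x

theorem chartDivision_right_unit {y : E} (hy : y ∈ (extChartAt I (1 : G)).target) :
    chartDivision I G (y, extChartAt I (1 : G) 1) = y := by
  simp only [chartDivision, extChartAt_to_inv, inv_one, mul_one, (extChartAt I (1 : G)).right_inv hy]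

theorem chartDivision_self (z : E) : chartDivision I G (z, z) = extChartAt I (1 : G) 1 := by
  simp [chartDivision]

theorem chartDivision_apply {g h : G} (hg : g ∈ (extChartAt I (1 : G)).source)
    (hh : h ∈ (extChartAt I (1 : G)).source) :
    chartDivision I G (extChartAt I 1 g, extChartAt I 1 h) = extChartAt I 1 (g * h⁻¹) := by
  simp only [chartDivision, (extChartAt I (1 : G)).left_inv hg, (extChartAt I (1 : G)).left_inv hh]

theorem eventually_chartDivision_right_unit [I.Boundaryless] :
    ∀ᶠ y in 𝓝 (extChartAt I (1 : G) 1),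
      chartDivision I G (y, extChartAt I (1 : G) 1) = y :=
  mem_of_superset (extChartAt_target_mem_nhds (I := I) (1 : G)) fun _ hy =>
    chartDivision_right_unit I hy

theorem contMDiffAt_extChartAt_one_symm [IsManifold I ∞ G] [I.Boundaryless] {n : ℕ∞ω} (hn : n ≤ ∞) :
    ContMDiffAt 𝓘(ℝ, E) I n (extChartAt I (1 : G)).symm (extChartAt I (1 : G) 1) := by
  have h := contMDiffWithinAt_extChartAt_symm_range_self (I := I) (n := ∞) (1 : G)
  rw [I.range_eq_univ] at h
  exact (contMDiffWithinAt_univ.1 h).of_le hn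

theorem contMDiffAt_extChartAt_one [IsManifold I ∞ G] {n : ℕ∞ω} (hn : n ≤ ∞) {g : G} (hg : g = 1) :
    ContMDiffAt I 𝓘(ℝ, E) n (extChartAt I (1 : G)) g := by
  subst hg
  exact (contMDiffAt_extChartAt (n := ∞)).of_le hn

variable [LieGroup I ∞ G]

theorem contDiffAt_chartDivision [I.Boundaryless] :
    ContDiffAt ℝ 2 (chartDivision I G) (extChartAt I (1 : G) 1, extChartAt I (1 : G) 1) := by
  have := contMDiffAt_extChartAt_one_symm I (G := G) (n := ∞) le_rfl
  rw [← contMDiffAt_iff_contDiffAt]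
  have h1 : ContMDiffAt 𝓘(ℝ, E × E) I ∞ (fun z : E × E => (extChartAt I (1 : G)).symm z.1)
      (extChartAt I (1 : G) 1, extChartAt I (1 : G) 1) :=
    ContMDiffAt.comp (g := (extChartAt I (1 : G)).symm) _ this contDiff_fst.contMDiff.contMDiffAt
  have h2 : ContMDiffAt 𝓘(ℝ, E × E) I ∞ (fun z : E × E => (extChartAt I (1 : G)).symm z.2)
      (extChartAt I (1 : G) 1, extChartAt I (1 : G) 1) :=
    ContMDiffAt.comp (g := (extChartAt I (1 : G)).symm) _ this contDiff_snd.contMDiff.contMDiffAt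
  exact ((contMDiffAt_extChartAt_one I le_rfl (by simp)).comp _ (h1.mul h2.inv)).of_le
    two_le_infty

/-- Tangent spaces are identified with `E` through preferred charts, so the preferred chart has
identity derivative at its base point. The hypothesis `g = 1` serves points such as `c x * (c x)⁻¹`,
which are only propositionally the unit. -/
theorem mfderiv_extChartAt_one_apply {g : G} (hg : g = 1) (v : E) :
    (mfderiv I 𝓘(ℝ, E) (extChartAt I (1 : G)) g : E →L[ℝ] E) v = v := by
  subst hg
  have : IsManifold I 1 G := IsManifold.of_le (n := ∞) (by simp)
  rw [mfderiv_extChartAt_self]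
  rfl

theorem contDiffWithinAt_extChartAt_mul_inv {n : ℕ∞ω} (hn : n ≤ ∞) {c : F → G} {S : Set F}
    {x₀ : F} (hc : ContMDiffWithinAt 𝓘(ℝ, F) I n c S x₀) :
    ContDiffWithinAt ℝ n (fun x => extChartAt I (1 : G) (c x * (c x₀)⁻¹)) S x₀ := by
  rw [← contMDiffWithinAt_iff_contDiffWithinAt]
  have : LieGroup I n G := LieGroup.of_le hn
  exact (contMDiffAt_extChartAt_one I hn (by simp)).comp_contMDiffWithinAt x₀
    (hc.mul contMDiffWithinAt_const)

/-- The translated derivative of a map into the group is its right logarithmic derivative. -/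
theorem rightTranslateToLieAlgebra_mfderivWithin {c : F → G} {S : Set F} {x : F}
    (hS : UniqueDiffWithinAt ℝ S x) (hc : MDifferentiableWithinAt 𝓘(ℝ, F) I c S x) (v : F) :
    (rightTranslateToLieAlgebra I (c x) (mfderivWithin 𝓘(ℝ, F) I c S x v) : E) =
      rightLogDeriv I c S x v := by
  have : LieGroup I 1 G := LieGroup.of_le (n := ∞) (by simp)
  have h1 := hc.hasMFDerivWithinAt
  have h2 : HasMFDerivAt I I (fun y => y * (c x)⁻¹) (c x) _ :=
    ((contMDiff_mul_right (I := I) (n := 1) (a := (c x)⁻¹)).contMDiffAt.mdifferentiableAt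
      (by simp)).hasMFDerivAt
  have h3 : HasMFDerivAt I 𝓘(ℝ, E) (extChartAt I (1 : G)) (c x * (c x)⁻¹) _ :=
    ((contMDiffAt_extChartAt_one I (n := 1) (by simp) (by simp)).mdifferentiableAt
      (by simp)).hasMFDerivAt
  obtain ⟨D, hD, hDv⟩ : ∃ D : F →L[ℝ] E,
      HasFDerivWithinAt (fun y => extChartAt I (1 : G) (c y * (c x)⁻¹)) D S x ∧
      D v = rightTranslateToLieAlgebra I (c x) (mfderivWithin 𝓘(ℝ, F) I c S x v) :=
    ⟨_, (h3.comp_hasMFDerivWithinAt x (h2.comp_hasMFDerivWithinAt x h1)).hasFDerivWithinAt,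
      mfderiv_extChartAt_one_apply I (mul_inv_cancel (c x)) _⟩
  rw [rightLogDeriv, hD.fderivWithin hS]
  exact hDv.symm

/-- Since c(y) c(x)⁻¹ = (c(y) c(x₀)⁻¹)(c(x) c(x₀)⁻¹)⁻¹, translating by c(x₀)⁻¹ brings everything
into the chart at the unit, where the quotient is M(u(y), u(x)); then differentiate in y at y = x.
-/
theorem eventually_rightLogDeriv_eq [I.Boundaryless] {c : F → G} {S : Set F} {x₀ : F}
    (hS : UniqueDiffOn ℝ S) (hx : x₀ ∈ S) (hc : ContMDiffWithinAt 𝓘(ℝ, F) I 2 c S x₀) :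
    ∀ᶠ x in 𝓝[S] x₀, rightLogDeriv I c S x =
      (fderiv ℝ (chartDivision I G) (extChartAt I (1 : G) (c x * (c x₀)⁻¹),
        extChartAt I (1 : G) (c x * (c x₀)⁻¹))).comp ((ContinuousLinearMap.inl ℝ E E).comp
        (fderivWithin ℝ (fun x => extChartAt I (1 : G) (c x * (c x₀)⁻¹)) S x)) := by
  set u : F → E := fun x => extChartAt I (1 : G) (c x * (c x₀)⁻¹) with hu
  have hus : ContDiffWithinAt ℝ 2 u S x₀ :=
    contDiffWithinAt_extChartAt_mul_inv I two_le_infty hc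
  have hu₀ : u x₀ = extChartAt I (1 : G) 1 := by simp [hu]
  have : IsTopologicalGroup G := topologicalGroup_of_lieGroup I ∞
  have hsrc : ∀ᶠ x in 𝓝[S] x₀, c x * (c x₀)⁻¹ ∈ (extChartAt I (1 : G)).source := by
    have : Tendsto (fun x => c x * (c x₀)⁻¹) (𝓝[S] x₀) (𝓝 (c x₀ * (c x₀)⁻¹)) :=
      hc.continuousWithinAt.mul tendsto_const_nhds
    rw [mul_inv_cancel] at this
    exact this.eventually (extChartAt_source_mem_nhds (I := I) (1 : G))
  have hM : ∀ᶠ x in 𝓝[S] x₀, HasFDerivAt (chartDivision I G)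
      (fderiv ℝ (chartDivision I G) (u x, u x)) (u x, u x) := by
    have : Tendsto (fun x => (u x, u x)) (𝓝[S] x₀) (𝓝 (u x₀, u x₀)) :=
      hus.continuousWithinAt.prodMk_nhds hus.continuousWithinAt
    rw [hu₀] at this
    exact this.eventually (eventually_hasFDerivAt (contDiffAt_chartDivision I))
  have hud : ∀ᶠ x in 𝓝[S] x₀, DifferentiableWithinAt ℝ u S x := by
    have := hus.eventually (by simp)
    rw [insert_eq_of_mem hx] at this
    exact this.mono fun x hx => hx.differentiableWithinAt (by simp)
  filter_upwards [eventually_eventually_nhdsWithin.2 hsrc, hM, hud, self_mem_nhdsWithin]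
    with x h1 h2 h3 hxS
  have h4 : (fun y => extChartAt I (1 : G) (c y * (c x)⁻¹)) =ᶠ[𝓝[S] x]
      fun y => chartDivision I G (u y, u x) := by
    filter_upwards [h1] with y hy
    rw [chartDivision_apply I hy (h1.self_of_nhdsWithin hxS)]
    congr 1
    group
  rw [rightLogDeriv, h4.fderivWithin_eq (h4.self_of_nhdsWithin hxS)]
  have h5 : HasFDerivWithinAt (fun y => chartDivision I G (u y, u x)) _ S x :=
    HasFDerivAt.comp_hasFDerivWithinAt x (g := chartDivision I G) (f := fun y => (u y, u x))
      h2 (h3.hasFDerivWithinAt.prodMk (hasFDerivWithinAt_const (u x) x S))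
  rw [h5.fderivWithin (hS x hxS)]
  ext v
  simp [-extChartAt, hu]

/-- The Maurer–Cartan equation for the right logarithmic derivative. -/
theorem maurerCartan_rightLogDeriv [I.Boundaryless] {c : F → G} {S : Set F} {x₀ : F}
    (hS : UniqueDiffOn ℝ S) (hx : x₀ ∈ S) (hx' : x₀ ∈ closure (interior S))
    (hc : ContMDiffWithinAt 𝓘(ℝ, F) I 2 c S x₀) :
    ContDiffWithinAt ℝ 1 (rightLogDeriv I c S) S x₀ ∧ ∀ v w,
      fderivWithin ℝ (rightLogDeriv I c S) S x₀ v w -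
        fderivWithin ℝ (rightLogDeriv I c S) S x₀ w v =
      divisionBracket (chartDivision I G) (extChartAt I (1 : G) 1)
        (rightLogDeriv I c S x₀ v) (rightLogDeriv I c S x₀ w) :=
  maurerCartan_of_division (contDiffAt_chartDivision I) (eventually_chartDivision_right_unit I)
    hS hx hx' (contDiffWithinAt_extChartAt_mul_inv I two_le_infty hc) (by simp)
    (eventually_rightLogDeriv_eq I hS hx hc)

end LogarithmicDerivative

/-! ### The Lie bracket in terms of the chart division -/

section Bracket

variable {E : Type*} [NormedAddCommGroup E] [NormedSpace ℝ E]
  {H : Type*} [TopologicalSpace H] (I : ModelWithCorners ℝ E H) [I.Boundaryless]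
  {G : Type*} [TopologicalSpace G] [ChartedSpace H G] [Group G] [LieGroup I ∞ G]

theorem fderiv_extChartAt_mul_left {g : G} (hg : g ∈ (extChartAt I (1 : G)).source) (v : E) :
    DifferentiableAt ℝ (fun y => extChartAt I (1 : G) (g * (extChartAt I (1 : G)).symm y))
      (extChartAt I (1 : G) 1) ∧
    (mfderiv I 𝓘(ℝ, E) (extChartAt I (1 : G)) g (mulInvariantVectorField v g) : E) =
      fderiv ℝ (fun y => extChartAt I (1 : G) (g * (extChartAt I (1 : G)).symm y))
        (extChartAt I (1 : G) 1) v := by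
  have : LieGroup I 1 G := LieGroup.of_le (n := ∞) (by simp)
  have h1 : MDifferentiableAt I I (fun y : G => g * y) 1 :=
    (contMDiff_mul_left (I := I) (n := 1) (a := g)).contMDiffAt.mdifferentiableAt (by simp)
  -- The chain rule lands at `g * 1`; generalizing the point avoids rewriting inside a dependent
  -- tangent space.
  have hφ : ∀ g' : G, g' = g → MDifferentiableAt I 𝓘(ℝ, E) (extChartAt I (1 : G)) g' ∧
      ∀ w : E, (mfderiv I 𝓘(ℝ, E) (extChartAt I (1 : G)) g' w : E) =
        (mfderiv I 𝓘(ℝ, E) (extChartAt I (1 : G)) g w : E) := by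
    rintro g' rfl
    exact ⟨mdifferentiableAt_extChartAt (by simpa using hg), fun _ => rfl⟩
  have h2 := (hφ (g * 1) (mul_one g)).1
  have h3 : MDifferentiableAt I 𝓘(ℝ, E) (fun y : G => extChartAt I (1 : G) (g * y)) 1 :=
    h2.comp 1 h1
  have h4 : mfderiv I 𝓘(ℝ, E) (fun y : G => extChartAt I (1 : G) (g * y)) 1 =
      (mfderiv I 𝓘(ℝ, E) (extChartAt I (1 : G)) (g * 1)).comp
        (mfderiv I I (fun y : G => g * y) 1) := mfderiv_comp 1 h2 h1
  have h5 := h3.differentiableWithinAt_writtenInExtChartAt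
  simp only [I.range_eq_univ, differentiableWithinAt_univ] at h5
  refine ⟨h5, ?_⟩
  have h6 := h3.mfderiv
  simp only [I.range_eq_univ, fderivWithin_univ] at h6
  refine ((hφ (g * 1) (mul_one g)).2 _).symm.trans ?_
  refine (congrArg (fun m : E →L[ℝ] E => m v) h4).symm.trans ?_
  exact congrArg (fun m : E →L[ℝ] E => m v) h6

/-- Multiplication is a double division, x y = x (1 y⁻¹)⁻¹, hence M(x, M(p, y)) in the chart. The
inner division contributes the minus sign. -/
theorem eventually_mulInvariantVectorField_eq (v : GroupLieAlgebra I G) :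
    ∀ᶠ x in 𝓝 (extChartAt I (1 : G) 1),
      VectorField.mpullback 𝓘(ℝ, E) I (extChartAt I (1 : G)).symm (mulInvariantVectorField v) x =
        -fderiv ℝ (chartDivision I G) (x, extChartAt I (1 : G) 1) (0, v) := by
  have : LieGroup I 1 G := LieGroup.of_le (n := ∞) (by simp)
  have : IsManifold I 1 G := inferInstance
  have : IsTopologicalGroup G := topologicalGroup_of_lieGroup I ∞
  set p := extChartAt I (1 : G) 1 with hp
  have hM := eventually_hasFDerivAt (contDiffAt_chartDivision I (G := G))
  have hc : Tendsto (fun x : E => (x, p)) (𝓝 p) (𝓝 (p, p)) :=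
    (continuous_id.prodMk continuous_const).tendsto' _ _ rfl
  filter_upwards [extChartAt_target_mem_nhds (I := I) (1 : G), hc.eventually hM] with x hx hMx
  have hxs := (extChartAt I (1 : G)).map_target hx
  obtain ⟨h1, h2⟩ := fderiv_extChartAt_mul_left I hxs v
  -- The pullback applies the inverse of the derivative of the inverse chart, which is the
  -- derivative of the chart.
  have h3 : VectorField.mpullback 𝓘(ℝ, E) I (extChartAt I (1 : G)).symm
      (mulInvariantVectorField v) x = (mfderiv I 𝓘(ℝ, E) (extChartAt I (1 : G))
        ((extChartAt I (1 : G)).symm x)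
        (mulInvariantVectorField v ((extChartAt I (1 : G)).symm x)) : E) := by
    rw [VectorField.mpullback_apply, ← mfderivWithin_univ, ← I.range_eq_univ,
      ContinuousLinearMap.inverse_eq (mfderivWithin_extChartAt_symm_comp_mfderiv_extChartAt hx)
      (mfderiv_extChartAt_comp_mfderivWithin_extChartAt_symm hx)]
    rfl
  rw [h3, h2]
  have h4 : (fun y => extChartAt I (1 : G) ((extChartAt I (1 : G)).symm x *
      (extChartAt I (1 : G)).symm y)) =ᶠ[𝓝 p]
      fun y => chartDivision I G (x, chartDivision I G (p, y)) := by
    have h5 : Tendsto (fun y => ((extChartAt I (1 : G)).symm y)⁻¹) (𝓝 p)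
        (𝓝 ((extChartAt I (1 : G)).symm p)⁻¹) :=
      (continuousAt_extChartAt_symm (I := I) (1 : G)).inv
    rw [hp, extChartAt_to_inv, inv_one] at h5
    filter_upwards [h5.eventually (extChartAt_source_mem_nhds (I := I) (1 : G))] with y hy
    simp only [chartDivision, hp, extChartAt_to_inv, one_mul, (extChartAt I (1 : G)).left_inv hy,
      inv_inv]
  rw [h4.fderiv_eq]
  have h6 : chartDivision I G (p, p) = p := chartDivision_self I p
  have h7 : HasFDerivAt (fun y => chartDivision I G (p, y)) _ p :=
    HasFDerivAt.comp p (g := chartDivision I G) (f := fun y => (p, y)) hM.self_of_nhds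
      ((hasFDerivAt_const p p).prodMk (hasFDerivAt_id p))
  have h8 : HasFDerivAt (fun y => chartDivision I G (x, chartDivision I G (p, y))) _ p :=
    HasFDerivAt.comp p (g := chartDivision I G) (f := fun y => (x, chartDivision I G (p, y)))
      (by rw [h6]; exact hMx) ((hasFDerivAt_const x p).prodMk h7)
  have h9 := fderiv_snd_of_division (contDiffAt_chartDivision I)
    (eventually_chartDivision_right_unit I) (Eventually.of_forall (chartDivision_self I (G := G)))
  rw [h8.fderiv]
  have h10 : ((0 : E), -(v : E)) = -((0 : E), (v : E)) := by simp
  exact (congrArg (fun w : E => fderiv ℝ (chartDivision I G) (x, p) ((0 : E), w)) (h9 v)).trans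
    ((congrArg _ h10).trans (map_neg _ _))

/-- The Lie bracket of left-invariant fields is the one read off from the division in a chart. -/
theorem bracket_eq_divisionBracket (v w : GroupLieAlgebra I G) :
    (⁅v, w⁆ : GroupLieAlgebra I G) =
      divisionBracket (chartDivision I G) (extChartAt I (1 : G) 1) v w := by
  have : LieGroup I 1 G := LieGroup.of_le (n := ∞) (by simp)
  have : IsManifold I 1 G := inferInstance
  set p := extChartAt I (1 : G) 1 with hp
  have hv : VectorField.mpullback 𝓘(ℝ, E) I (extChartAt I (1 : G)).symm
      (mulInvariantVectorField v) =ᶠ[𝓝 p] fun x : E =>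
        (-fderiv ℝ (chartDivision I G) (x, p) (0, (v : E)) : E) :=
    eventually_mulInvariantVectorField_eq I v
  have hw : VectorField.mpullback 𝓘(ℝ, E) I (extChartAt I (1 : G)).symm
      (mulInvariantVectorField w) =ᶠ[𝓝 p] fun x : E =>
        (-fderiv ℝ (chartDivision I G) (x, p) (0, (w : E)) : E) :=
    eventually_mulInvariantVectorField_eq I w
  rw [GroupLieAlgebra.bracket_def, ← VectorField.mlieBracketWithin_univ,
    VectorField.mlieBracketWithin_apply]
  simp only [I.range_eq_univ, preimage_univ, univ_inter, VectorField.mpullbackWithin_univ]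
  have h4 : ∀ D : E →L[ℝ] E, D = ContinuousLinearMap.id ℝ E → ∀ z, D.inverse z = z := by
    rintro _ rfl z
    rw [ContinuousLinearMap.inverse_id, ContinuousLinearMap.id_apply]
  refine (h4 _ mfderiv_extChartAt_self _).trans ?_
  have h5 : VectorField.lieBracket ℝ (VectorField.mpullback 𝓘(ℝ, E) I
      (extChartAt I (1 : G)).symm (mulInvariantVectorField v))
      (VectorField.mpullback 𝓘(ℝ, E) I (extChartAt I (1 : G)).symm (mulInvariantVectorField w))
      p = VectorField.lieBracket ℝ
        (fun x : E => (-fderiv ℝ (chartDivision I G) (x, p) (0, (v : E)) : E))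
        (fun x : E => (-fderiv ℝ (chartDivision I G) (x, p) (0, (w : E)) : E)) p :=
    hv.lieBracket_vectorField_eq hw
  exact (congrFun VectorField.lieBracketWithin_univ p).trans (h5.trans
    (lieBracket_neg_fderiv_snd (contDiffAt_chartDivision I)
      (eventually_chartDivision_right_unit I) (Eventually.of_forall (chartDivision_self I)) v w))

end Bracket

/-! ### Expressing an invariant Lagrangian through l and logarithmic derivatives -/

section Reduction

variable {E : Type*} [NormedAddCommGroup E] [NormedSpace ℝ E]
  {H : Type*} [TopologicalSpace H] (I : ModelWithCorners ℝ E H)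
  {G : Type*} [TopologicalSpace G] [ChartedSpace H G] [Group G]
  {F : Type*} [NormedAddCommGroup F] [NormedSpace ℝ F]
  {F' : Type*} [NormedAddCommGroup F'] [NormedSpace ℝ F']

omit [Group G] in
theorem contMDiffAt_extend_symm [IsManifold I ∞ G] [I.Boundaryless] {e : OpenPartialHomeomorph G H}
    (he : e ∈ IsManifold.maximalAtlas I ∞ G) {q : E} (hq : q ∈ (e.extend I).target) :
    ContMDiffAt 𝓘(ℝ, E) I ∞ (e.extend I).symm q := by
  refine ((contMDiffOn_extend_symm he) q ?_).contMDiffAt ?_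
  · rwa [← e.extend_target']
  · rw [← e.extend_target']
    exact e.isOpen_extend_target.mem_nhds hq

-- In the trivialization at `g` itself, the fibre coordinate over `g` is the vector unchanged. This
-- makes l smooth.
omit [Group G] in
theorem contMDiff_fiber_inclusion [IsManifold I ∞ G] (g : G) :
    ContMDiff 𝓘(ℝ, E) I.tangent ∞ (fun v : E => (⟨g, v⟩ : TangentBundle I G)) := by
  intro v
  have : IsManifold I 1 G := IsManifold.of_le (n := ∞) (by simp)
  rw [Bundle.contMDiffAt_totalSpace]
  refine ⟨contMDiffAt_const, ?_⟩
  have h : ∀ w : E, (trivializationAt E (TangentSpace I) g (⟨g, w⟩ : TangentBundle I G)).2 = w := by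
    intro w
    have h1 := TangentBundle.continuousLinearMapAt_trivializationAt (I := I)
      (mem_chart_source H g)
    rw [mfderiv_extChartAt_self] at h1
    have h2 := congrArg (fun m : E →L[ℝ] E => m w) h1
    refine Eq.trans ?_ h2
    exact (Bundle.Trivialization.continuousLinearMapAt_apply_of_mem
      (trivializationAt E (TangentSpace I) g) (R := ℝ) (by simp) w).symm
  simp only [h]
  exact contMDiffAt_id

theorem contDiff_reducedLagrangian [IsManifold I ∞ G] {L : TangentBundle I G → ℝ}
    (hL : ContMDiff I.tangent 𝓘(ℝ, ℝ) ∞ L) :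
    ContDiff ℝ 2 (fun v : E => reducedLagrangian I L v) :=
  ((hL.comp (contMDiff_fiber_inclusion I (1 : G))).contDiff).of_le two_le_infty

theorem IsRightInvariant.eq_reducedLagrangian {L : TangentBundle I G → ℝ}
    (hinv : IsRightInvariant I L) (g : G) (v : TangentSpace I g) :
    L ⟨g, v⟩ = reducedLagrangian I L (rightTranslateToLieAlgebra I g v) := by
  have h : ∀ (h : G) (w : E), h = 1 → L ⟨h, w⟩ = L ⟨1, w⟩ := by
    rintro h w rfl
    rfl
  exact (hinv g g⁻¹ v).symm.trans (h _ _ (mul_inv_cancel g))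

theorem IsRightInvariant.action_eq {L : TangentBundle I G → ℝ}
    (hinv : IsRightInvariant I L) (a b : ℝ) (c : ℝ → G) :
    action I L a b c = ∫ t in a..b, reducedLagrangian I L (reducedVelocity I a b c t) := by
  unfold action
  congr 1
  ext t
  exact hinv.eq_reducedLagrangian I _ _

theorem rightLogDeriv_congr {c c' : F → G} {S : Set F} {x : F} (h : c =ᶠ[𝓝[S] x] c')
    (hx : c x = c' x) : rightLogDeriv I c S x = rightLogDeriv I c' S x := by
  refine EventuallyEq.fderivWithin_eq ?_ (by simp [hx])
  filter_upwards [h] with y hy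
  rw [hy, hx]

variable [LieGroup I ∞ G]

theorem rightLogDeriv_comp {c : F → G} {k : F' → F} {S : Set F} {T : Set F'} {y : F'}
    {k' : F' →L[ℝ] F} (hc : ContMDiffWithinAt 𝓘(ℝ, F) I 2 c S (k y))
    (hk : HasFDerivWithinAt k k' T y) (hT : UniqueDiffWithinAt ℝ T y)
    (hmaps : MapsTo k T S) :
    rightLogDeriv I (fun z => c (k z)) T y = (rightLogDeriv I c S (k y)).comp k' :=
  ((((contDiffWithinAt_extChartAt_mul_inv I two_le_infty hc).differentiableWithinAt
    (by simp)).hasFDerivWithinAt).comp y hk hmaps).fderivWithin hT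

theorem reducedVelocity_eq_rightLogDeriv {a b : ℝ} (hab : a < b) {c : ℝ → G} {t : ℝ}
    (ht : t ∈ Icc a b) (hc : ContMDiffWithinAt 𝓘(ℝ, ℝ) I 2 c (Icc a b) t) :
    (reducedVelocity I a b c t : E) = rightLogDeriv I c (Icc a b) t 1 :=
  rightTranslateToLieAlgebra_mfderivWithin I (uniqueDiffOn_Icc hab t ht)
    (hc.mdifferentiableWithinAt (by simp)) 1

/-- This is the form l(A(q)v) that `hasDerivWithinAt_fderiv_iff` needs. -/
theorem localLagrangian_eq [I.Boundaryless] {L : TangentBundle I G → ℝ}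
    (hinv : IsRightInvariant I L) {e : OpenPartialHomeomorph G H}
    (he : e ∈ IsManifold.maximalAtlas I ∞ G) {q : E} (hq : q ∈ (e.extend I).target) (v : E) :
    localLagrangian I L e q v =
      reducedLagrangian I L (rightLogDeriv I (e.extend I).symm univ q v : E) := by
  refine (hinv.eq_reducedLagrangian I _ _).trans (congrArg (reducedLagrangian I L) ?_)
  rw [← mfderivWithin_univ]
  exact rightTranslateToLieAlgebra_mfderivWithin I uniqueDiffWithinAt_univ
    ((contMDiffAt_extend_symm I he hq).mdifferentiableAt (by simp)).mdifferentiableWithinAt v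

/-- Right translation by h, read from the chart at the unit to `e`, is a map ψ that division by h
undoes. Its derivative is therefore a right inverse of the logarithmic derivative. -/
theorem surjective_rightLogDeriv_extend_symm [I.Boundaryless] {e : OpenPartialHomeomorph G H}
    (he : e ∈ IsManifold.maximalAtlas I ∞ G) {q : E} (hq : q ∈ (e.extend I).target) :
    Function.Surjective (rightLogDeriv I (e.extend I).symm univ q) := by
  set h : G := (e.extend I).symm q with hh
  have hhs : h ∈ e.source := by
    rw [← e.extend_source (I := I)]
    exact (e.extend I).map_target hq
  set p := extChartAt I (1 : G) 1 with hp
  set ψ : E → E := fun x => e.extend I ((extChartAt I (1 : G)).symm x * h) with hψ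
  have hψp : ψ p = q := by
    simp only [hψ, hp, extChartAt_to_inv, one_mul]
    exact (e.extend I).right_inv hq
  have hmul : ContMDiffAt 𝓘(ℝ, E) I ∞ (fun x => (extChartAt I (1 : G)).symm x * h) p :=
    (contMDiffAt_extChartAt_one_symm I le_rfl).mul contMDiffAt_const
  have hval : (extChartAt I (1 : G)).symm p * h = h := by rw [hp, extChartAt_to_inv, one_mul]
  have hd : DifferentiableAt ℝ ψ p := by
    have h1 : ContMDiffAt I 𝓘(ℝ, E) ∞ (e.extend I) ((extChartAt I (1 : G)).symm p * h) :=
      e.contMDiffAt_extend he (by rwa [hval])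
    exact (h1.comp p hmul).contDiffAt.differentiableAt (by simp)
  have hr : (fun x => extChartAt I (1 : G) ((e.extend I).symm (ψ x) * h⁻¹)) =ᶠ[𝓝 p] id := by
    have hev : ∀ᶠ x in 𝓝 p, (extChartAt I (1 : G)).symm x * h ∈ e.source :=
      hmul.continuousAt.eventually (e.open_source.mem_nhds (by simpa only [hval]))
    filter_upwards [hev, extChartAt_target_mem_nhds (I := I) (1 : G)] with x hx hxt
    rw [hψ, (e.extend I).left_inv (by rwa [e.extend_source]), mul_inv_cancel_right,
      (extChartAt I (1 : G)).right_inv hxt, id]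
  have hA : HasFDerivAt (fun y => extChartAt I (1 : G) ((e.extend I).symm y * h⁻¹))
      (rightLogDeriv I (e.extend I).symm univ q) (ψ p) := by
    rw [hψp, rightLogDeriv, fderivWithin_univ]
    have := contDiffWithinAt_extChartAt_mul_inv I le_rfl (S := univ)
      (contMDiffAt_extend_symm I he hq)
    exact ((contDiffWithinAt_univ.1 this).differentiableAt (by simp)).hasFDerivAt
  have hcomp := (hA.comp p hd.hasFDerivAt).unique ((hasFDerivAt_id p).congr_of_eventuallyEq hr)
  intro w
  exact ⟨fderiv ℝ ψ p w, congrArg (fun m => m w) hcomp⟩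

end Reduction

/-! ### Deformations and constrained variations -/

section Deformation

/-- Needed for symmetry of second derivatives up to the edges t = a and t = b. -/
theorem subset_closure_interior_strip {a b ε : ℝ} (hab : a < b) :
    Icc a b ×ˢ Ioo (-ε) ε ⊆ closure (interior (Icc a b ×ˢ Ioo (-ε) ε)) := by
  rw [interior_prod_eq, closure_prod_eq, interior_Icc, closure_Ioo hab.ne, isOpen_Ioo.interior_eq]
  exact prod_mono_right subset_closure

theorem uniqueDiffOn_strip {a b ε : ℝ} (hab : a < b) :
    UniqueDiffOn ℝ (Icc a b ×ˢ Ioo (-ε) ε) :=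
  (uniqueDiffOn_Icc hab).prod isOpen_Ioo.uniqueDiffOn

variable {E : Type*} [NormedAddCommGroup E] [NormedSpace ℝ E]

theorem hasDerivWithinAt_slice_fst {Θ : ℝ × ℝ → ℝ × ℝ →L[ℝ] E} {T U : Set ℝ} {t s : ℝ}
    (h : DifferentiableWithinAt ℝ Θ (T ×ˢ U) (t, s)) (hs : s ∈ U) (v : ℝ × ℝ) :
    HasDerivWithinAt (fun t => Θ (t, s) v) (fderivWithin ℝ Θ (T ×ˢ U) (t, s) (1, 0) v) T t := by
  have h1 : HasDerivWithinAt (fun t : ℝ => (t, s)) (1, 0) T t :=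
    ((hasDerivAt_id' t).prodMk (hasDerivAt_const t s)).hasDerivWithinAt
  have h2 : MapsTo (fun t : ℝ => (t, s)) T (T ×ˢ U) := fun t ht => ⟨ht, hs⟩
  have h3 : HasDerivWithinAt (fun t : ℝ => Θ (t, s)) _ T t :=
    h.hasFDerivWithinAt.comp_hasDerivWithinAt t h1 h2
  simpa using h3.clm_apply (hasDerivWithinAt_const t T v)

theorem hasDerivWithinAt_slice_snd {Θ : ℝ × ℝ → ℝ × ℝ →L[ℝ] E} {T U : Set ℝ} {t s : ℝ}
    (h : DifferentiableWithinAt ℝ Θ (T ×ˢ U) (t, s)) (ht : t ∈ T) (v : ℝ × ℝ) :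
    HasDerivWithinAt (fun s => Θ (t, s) v) (fderivWithin ℝ Θ (T ×ˢ U) (t, s) (0, 1) v) U s := by
  have h1 : HasDerivWithinAt (fun s : ℝ => (t, s)) (0, 1) U s :=
    (hasDerivWithinAt_const s _ t).prodMk (hasDerivAt_id s).hasDerivWithinAt
  have h2 : MapsTo (fun s : ℝ => (t, s)) U (T ×ˢ U) := fun s hs => ⟨ht, hs⟩
  exact ((h.hasFDerivWithinAt.comp_hasDerivWithinAt s h1 h2).clm_apply
    (hasDerivWithinAt_const s U v)).congr_deriv (by simp)

variable
  {H : Type*} [TopologicalSpace H] (I : ModelWithCorners ℝ E H) [I.Boundaryless]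
  {G : Type*} [TopologicalSpace G] [ChartedSpace H G] [Group G] [LieGroup I ∞ G]

/-- The field `(t, s) ↦ δc(t, s) c(t, s)⁻¹` along a deformation `c`. -/
def variationField (a b ε : ℝ) (c : ℝ → ℝ → G) (t : ℝ) : E :=
  rightLogDeriv I (fun p : ℝ × ℝ => c p.1 p.2) (Icc a b ×ˢ Ioo (-ε) ε) (t, 0) (0, 1)

/-- The reduced velocity, as a curve in the model space. -/
def modelVelocity (a b : ℝ) (c : ℝ → G) (t : ℝ) : E :=
  reducedVelocity I a b c t

variable {I} {a b ε : ℝ} {g : ℝ → G} {c : ℝ → ℝ → G}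

omit [I.Boundaryless] in
theorem IsDeformation.modelVelocity_eq (hc : IsDeformation I a b g ε c) (hab : a < b) {t s : ℝ}
    (ht : t ∈ Icc a b) (hs : s ∈ Ioo (-ε) ε) :
    modelVelocity I a b (fun t => c t s) t =
      rightLogDeriv I (fun p : ℝ × ℝ => c p.1 p.2) (Icc a b ×ˢ Ioo (-ε) ε) (t, s) (1, 0) := by
  have hk : HasFDerivWithinAt (fun t : ℝ => (t, s)) (ContinuousLinearMap.inl ℝ ℝ ℝ) (Icc a b) t :=
    (hasFDerivAt_prodMk_left t s).hasFDerivWithinAt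
  have hm : MapsTo (fun t : ℝ => (t, s)) (Icc a b) (Icc a b ×ˢ Ioo (-ε) ε) :=
    fun t ht => ⟨ht, hs⟩
  have hcs := hc.contMDiffOn (t, s) ⟨ht, hs⟩
  have hc1 : ContMDiffWithinAt 𝓘(ℝ, ℝ) I 2 (fun t => c t s) (Icc a b) t :=
    ContMDiffWithinAt.comp (g := fun p : ℝ × ℝ => c p.1 p.2) (f := fun t : ℝ => (t, s)) t hcs
      (contDiff_id.prodMk contDiff_const).contMDiff.contMDiffAt.contMDiffWithinAt hm
  rw [modelVelocity, reducedVelocity_eq_rightLogDeriv I hab ht hc1]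
  have := rightLogDeriv_comp (c := fun p : ℝ × ℝ => c p.1 p.2) (k := fun t : ℝ => (t, s)) I hcs hk
    (uniqueDiffOn_Icc hab t ht) hm
  exact (congrArg (fun m : ℝ →L[ℝ] E => m 1) this).trans (by simp)

omit [I.Boundaryless] in
theorem IsDeformation.variationField_eq (hc : IsDeformation I a b g ε c) (hε : 0 < ε) {t : ℝ}
    (ht : t ∈ Icc a b) :
    variationField I a b ε c t = rightLogDeriv I (fun s => c t s) (Ioo (-ε) ε) 0 1 := by
  have h0 : (0 : ℝ) ∈ Ioo (-ε) ε := ⟨by linarith, hε⟩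
  have hk : HasFDerivWithinAt (fun s : ℝ => (t, s)) (ContinuousLinearMap.inr ℝ ℝ ℝ)
      (Ioo (-ε) ε) 0 := (hasFDerivAt_prodMk_right t 0).hasFDerivWithinAt
  have := rightLogDeriv_comp (c := fun p : ℝ × ℝ => c p.1 p.2) (k := fun s : ℝ => (t, s)) I
    (hc.contMDiffOn (t, 0) ⟨ht, h0⟩) hk (isOpen_Ioo.uniqueDiffOn 0 h0) fun s hs => ⟨ht, hs⟩
  exact ((congrArg (fun m : ℝ →L[ℝ] E => m 1) this).trans (by simp [variationField])).symm

omit [I.Boundaryless] in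
theorem IsDeformation.variationField_eq_zero (hc : IsDeformation I a b g ε c) (hε : 0 < ε) {t : ℝ}
    (ht : t ∈ Icc a b) (h : ∀ s ∈ Ioo (-ε) ε, c t s = g t) : variationField I a b ε c t = 0 := by
  have h0 : (0 : ℝ) ∈ Ioo (-ε) ε := ⟨by linarith, hε⟩
  rw [hc.variationField_eq hε ht, rightLogDeriv_congr (c' := fun _ => g t) I
    (eventually_nhdsWithin_of_forall h) (h 0 h0)]
  simp [rightLogDeriv]

theorem IsDeformation.contDiffOn_rightLogDeriv (hc : IsDeformation I a b g ε c) (hab : a < b) :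
    ContDiffOn ℝ 1 (rightLogDeriv I (fun p : ℝ × ℝ => c p.1 p.2) (Icc a b ×ˢ Ioo (-ε) ε))
      (Icc a b ×ˢ Ioo (-ε) ε) := fun p hp =>
  (maurerCartan_rightLogDeriv I (uniqueDiffOn_strip hab) hp (subset_closure_interior_strip hab hp)
    (hc.contMDiffOn p hp)).1

theorem IsDeformation.hasDerivWithinAt_variationField (hc : IsDeformation I a b g ε c)
    (hab : a < b) (hε : 0 < ε) {t : ℝ} (ht : t ∈ Icc a b) :
    HasDerivWithinAt (variationField I a b ε c)
      (fderivWithin ℝ (rightLogDeriv I (fun p : ℝ × ℝ => c p.1 p.2) (Icc a b ×ˢ Ioo (-ε) ε))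
        (Icc a b ×ˢ Ioo (-ε) ε) (t, 0) (1, 0) (0, 1)) (Icc a b) t := by
  have h0 : (0 : ℝ) ∈ Ioo (-ε) ε := ⟨by linarith, hε⟩
  exact hasDerivWithinAt_slice_fst
    ((hc.contDiffOn_rightLogDeriv hab).differentiableOn (by simp) (t, 0) ⟨ht, h0⟩) h0 (0, 1)

theorem IsDeformation.hasDerivAt_modelVelocity (hc : IsDeformation I a b g ε c)
    (hab : a < b) {t s : ℝ} (ht : t ∈ Icc a b) (hs : s ∈ Ioo (-ε) ε) :
    HasDerivAt (fun s => modelVelocity I a b (fun t => c t s) t)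
      (fderivWithin ℝ (rightLogDeriv I (fun p : ℝ × ℝ => c p.1 p.2) (Icc a b ×ˢ Ioo (-ε) ε))
        (Icc a b ×ˢ Ioo (-ε) ε) (t, s) (0, 1) (1, 0)) s := by
  have h3 := hasDerivWithinAt_slice_snd
    ((hc.contDiffOn_rightLogDeriv hab).differentiableOn (by simp) (t, s) ⟨ht, hs⟩) ht (1, 0)
  refine HasDerivWithinAt.hasDerivAt ?_ (isOpen_Ioo.mem_nhds hs)
  refine HasDerivWithinAt.congr h3 (fun s hs => ?_) ?_
  · exact hc.modelVelocity_eq hab ht hs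
  · exact hc.modelVelocity_eq hab ht hs

omit [I.Boundaryless] in
theorem modelVelocity_congr (hab : a < b) {c c' : ℝ → G} {t : ℝ}
    (hc : ContMDiffOn 𝓘(ℝ, ℝ) I 2 c (Icc a b)) (h : EqOn c' c (Icc a b)) (ht : t ∈ Icc a b) :
    modelVelocity I a b c' t = modelVelocity I a b c t := by
  rw [modelVelocity, modelVelocity, reducedVelocity_eq_rightLogDeriv I hab ht (hc t ht),
    reducedVelocity_eq_rightLogDeriv I hab ht ((hc.congr h) t ht),
    rightLogDeriv_congr I h.eventuallyEq_nhdsWithin (h ht)]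

/-- The reduced velocities of a deformation form a constrained variation. -/
theorem IsDeformation.isConstrainedVariation (hc : IsDeformation I a b g ε c) (hab : a < b)
    (hε : 0 < ε) (hg : ContMDiffOn 𝓘(ℝ, ℝ) I 2 g (Icc a b)) :
    IsConstrainedVariation I a b (reducedVelocity I a b g) (variationField (E := E) I a b ε c) ε
      (fun t s => reducedVelocity I a b (fun t => c t s) t) := by
  have h0 : (0 : ℝ) ∈ Ioo (-ε) ε := ⟨by linarith, hε⟩
  have hS := hc.contDiffOn_rightLogDeriv hab
  have hz : ∀ t ∈ Icc a b, modelVelocity I a b (fun t => c t 0) t =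
      modelVelocity I a b g t := fun t ht => modelVelocity_congr hab hg hc.at_zero ht
  have hd : ∀ t ∈ Icc a b, ∀ s ∈ Ioo (-ε) ε, deriv (fun s => modelVelocity I a b
      (fun t => c t s) t) s = fderivWithin ℝ (rightLogDeriv I (fun p : ℝ × ℝ => c p.1 p.2)
        (Icc a b ×ˢ Ioo (-ε) ε)) (Icc a b ×ˢ Ioo (-ε) ε) (t, s) (0, 1) (1, 0) :=
    fun t ht s hs => (hc.hasDerivAt_modelVelocity hab ht hs).deriv
  have hd' : ∀ t ∈ Icc a b, ∀ s ∈ Ioo (-ε) ε, DifferentiableAt ℝ (fun s => modelVelocity I a b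
      (fun t => c t s) t) s := fun t ht s hs =>
    (hc.hasDerivAt_modelVelocity hab ht hs).differentiableAt
  refine ⟨?_, hd', ?_, hz, fun t ht => ?_⟩
  · have h1 : ContinuousOn (fun p : ℝ × ℝ => rightLogDeriv I (fun p : ℝ × ℝ => c p.1 p.2)
        (Icc a b ×ˢ Ioo (-ε) ε) p (1, 0)) (Icc a b ×ˢ Ioo (-ε) ε) :=
      hS.continuousOn.clm_apply continuousOn_const
    exact h1.congr fun p hp => hc.modelVelocity_eq hab hp.1 hp.2
  · have h1 : ContinuousOn (fun p : ℝ × ℝ => fderivWithin ℝ (rightLogDeriv I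
        (fun p : ℝ × ℝ => c p.1 p.2) (Icc a b ×ˢ Ioo (-ε) ε)) (Icc a b ×ˢ Ioo (-ε) ε) p
        (0, 1) (1, 0)) (Icc a b ×ˢ Ioo (-ε) ε) :=
      ((hS.continuousOn_fderivWithin (uniqueDiffOn_strip hab) le_rfl).clm_apply
        continuousOn_const).clm_apply continuousOn_const
    exact h1.congr fun p hp => hd p.1 hp.1 p.2 hp.2
  -- Maurer–Cartan on the two coordinate directions gives η̇ − ∂ₛξ = [ξ, η] at s = 0, which is then
  -- solved for ∂ₛξ.
  · have hmc := (maurerCartan_rightLogDeriv I (uniqueDiffOn_strip hab)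
      (show (t, (0 : ℝ)) ∈ Icc a b ×ˢ Ioo (-ε) ε from ⟨ht, h0⟩)
      (subset_closure_interior_strip hab ⟨ht, h0⟩) (hc.contMDiffOn (t, 0) ⟨ht, h0⟩)).2
      (1, 0) (0, 1)
    rw [← hc.modelVelocity_eq hab ht h0, hz t ht] at hmc
    have h2 := (hc.hasDerivWithinAt_variationField hab hε ht).derivWithin
      (uniqueDiffOn_Icc hab t ht)
    have h3 := bracket_eq_divisionBracket I (G := G) (modelVelocity (E := E) I a b g t)
      (variationField (E := E) I a b ε c t)
    refine (hd t ht 0 h0).trans (Eq.trans ?_ (congrArg₂ (fun x y : E => x - y) h2 h3).symm)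
    refine Eq.trans ?_ (congrArg (fun z : E => _ - z) hmc)
    exact (sub_sub_cancel _ _).symm

theorem IsDeformation.continuousOn_derivWithin_variationField (hc : IsDeformation I a b g ε c)
    (hab : a < b) (hε : 0 < ε) :
    ContinuousOn (derivWithin (variationField I a b ε c) (Icc a b)) (Icc a b) := by
  have h0 : (0 : ℝ) ∈ Ioo (-ε) ε := ⟨by linarith, hε⟩
  have h1 : ContinuousOn (fun p : ℝ × ℝ => fderivWithin ℝ (rightLogDeriv I
      (fun p : ℝ × ℝ => c p.1 p.2) (Icc a b ×ˢ Ioo (-ε) ε)) (Icc a b ×ˢ Ioo (-ε) ε) p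
      (1, 0) (0, 1)) (Icc a b ×ˢ Ioo (-ε) ε) :=
    (((hc.contDiffOn_rightLogDeriv hab).continuousOn_fderivWithin (uniqueDiffOn_strip hab)
      le_rfl).clm_apply continuousOn_const).clm_apply continuousOn_const
  have h2 : ContinuousOn (fun t : ℝ => (t, (0 : ℝ))) (Icc a b) := by fun_prop
  exact (h1.comp h2 fun t ht => ⟨ht, h0⟩).congr fun t ht =>
    (hc.hasDerivWithinAt_variationField hab hε ht).derivWithin (uniqueDiffOn_Icc hab t ht)

/-- Every smooth path in the Lie algebra vanishing at the end points is the variation field of a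
deformation of `g`. -/
theorem exists_isDeformation (hab : a < b) (hg : ContMDiffOn 𝓘(ℝ, ℝ) I 2 g (Icc a b)) {η : ℝ → E}
    (hη : ContDiff ℝ ∞ η) (ha : η a = 0) (hb : η b = 0) :
    ∃ ε > 0, ∃ c : ℝ → ℝ → G, IsDeformation I a b g ε c ∧
      ∀ t ∈ Icc a b, variationField I a b ε c t = η t := by
  set p := extChartAt I (1 : G) 1 with hp
  obtain ⟨r, hr, hball⟩ := Metric.mem_nhds_iff.1 (extChartAt_target_mem_nhds (I := I) (1 : G))
  obtain ⟨C, hC⟩ := isCompact_Icc.exists_bound_of_continuousOn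
    (hη.continuous.continuousOn (s := Icc a b))
  have hC0 : 0 ≤ C := (norm_nonneg _).trans (hC a (left_mem_Icc.2 hab.le))
  -- Keeps p + sη(t) in the r-ball inside the chart target; the +1 covers C = 0.
  set ε := r / (C + 1) with hε
  have hε0 : 0 < ε := by positivity
  have hmem : ∀ t ∈ Icc a b, ∀ s ∈ Ioo (-ε) ε, p + s • η t ∈ (extChartAt I (1 : G)).target := by
    intro t ht s hs
    apply hball
    rw [Metric.mem_ball, dist_eq_norm, add_sub_cancel_left, norm_smul]
    have h1 : ‖s‖ < ε := by rw [Real.norm_eq_abs]; exact abs_lt.2 hs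
    calc ‖s‖ * ‖η t‖ ≤ ‖s‖ * (C + 1) := by
          gcongr
          linarith [hC t ht]
      _ < ε * (C + 1) := by gcongr
      _ = r := by rw [hε]; field_simp
  have h0 : (0 : ℝ) ∈ Ioo (-ε) ε := ⟨by linarith, hε0⟩
  -- A straight segment in the chart at the unit, translated by g(t): then c(t, s) c(t, 0)⁻¹ has
  -- coordinates p + sη(t), whose s-derivative is η(t).
  set c : ℝ → ℝ → G := fun t s => (extChartAt I (1 : G)).symm (p + s • η t) * g t with hcdef
  have hone : ∀ t, (extChartAt I (1 : G)).symm (p + (0 : ℝ) • η t) = 1 := fun t => by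
    rw [zero_smul, add_zero, hp, extChartAt_to_inv]
  have hend : ∀ t, η t = 0 → ∀ s, c t s = g t := fun t ht s => by
    simp only [hcdef, ht, smul_zero, add_zero, hp, extChartAt_to_inv, one_mul]
  have : LieGroup I 2 G := LieGroup.of_le two_le_infty
  have hc : IsDeformation I a b g ε c := by
    refine ⟨?_, fun t _ => by simp only [hcdef, hone, one_mul], fun s _ => hend a ha s,
      fun s _ => hend b hb s⟩
    have h1 : ContMDiffOn 𝓘(ℝ, ℝ × ℝ) 𝓘(ℝ, E) 2 (fun q : ℝ × ℝ => p + q.2 • η q.1)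
        (Icc a b ×ˢ Ioo (-ε) ε) :=
      (contDiff_const.add (contDiff_snd.smul
        ((hη.of_le two_le_infty).comp contDiff_fst))).contMDiff.contMDiffOn
    have h2 : ContMDiffOn 𝓘(ℝ, ℝ × ℝ) I 2
        (fun q : ℝ × ℝ => (extChartAt I (1 : G)).symm (p + q.2 • η q.1))
        (Icc a b ×ˢ Ioo (-ε) ε) :=
      (contMDiffOn_extChartAt_symm (I := I) (n := 2) (1 : G)).comp h1
        fun q hq => hmem q.1 hq.1 q.2 hq.2
    have h3 : ContMDiffOn 𝓘(ℝ, ℝ × ℝ) I 2 (fun q : ℝ × ℝ => g q.1) (Icc a b ×ˢ Ioo (-ε) ε) :=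
      hg.comp contDiff_fst.contMDiff.contMDiffOn fun q hq => hq.1
    exact h2.mul h3
  refine ⟨ε, hε0, c, hc, fun t ht => ?_⟩
  rw [hc.variationField_eq hε0 ht, rightLogDeriv]
  have h4 : HasFDerivWithinAt (fun s : ℝ => p + s • η t)
      ((ContinuousLinearMap.id ℝ ℝ).smulRight (η t)) (Ioo (-ε) ε) 0 :=
    ((hasFDerivAt_id (0 : ℝ)).smul_const (η t)).const_add p |>.hasFDerivWithinAt
  have h5 : ∀ s ∈ Ioo (-ε) ε, extChartAt I (1 : G) (c t s * (c t 0)⁻¹) = p + s • η t := by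
    intro s hs
    simp only [hcdef, hone, one_mul, mul_inv_cancel_right]
    exact (extChartAt I (1 : G)).right_inv (hmem t ht s hs)
  rw [(h4.congr h5 (h5 0 h0)).fderivWithin (isOpen_Ioo.uniqueDiffOn 0 h0)]
  simp

end Deformation

/-! ### The implications between the four statements -/

section Equivalences

variable {E : Type*} [NormedAddCommGroup E] [NormedSpace ℝ E]
  {H : Type*} [TopologicalSpace H] {I : ModelWithCorners ℝ E H} [I.Boundaryless]
  {G : Type*} [TopologicalSpace G] [ChartedSpace H G] [Group G] [LieGroup I ∞ G]
  {L : TangentBundle I G → ℝ} {a b : ℝ} {g : ℝ → G}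

variable (I G) in
/-- The bracket of `𝔤` as a continuous bilinear map on the model space. -/
def modelBracket : E →L[ℝ] E →L[ℝ] E :=
  divisionBracket (chartDivision I G) (extChartAt I (1 : G) 1)

variable (L) in
/-- The reduced Lagrangian, as a function on the model space. -/
def modelLagrangian (v : E) : ℝ := reducedLagrangian I L v

omit [I.Boundaryless] in
theorem contDiff_modelLagrangian (hL : ContMDiff I.tangent 𝓘(ℝ, ℝ) ∞ L) :
    ContDiff ℝ 2 (modelLagrangian L) :=
  contDiff_reducedLagrangian I hL

theorem coadjointOp_eq [FiniteDimensional ℝ E] (ξ : E) (μ : E →L[ℝ] ℝ) :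
    (coadjointOp I (G := G) ξ μ : E →L[ℝ] ℝ) = μ.comp (modelBracket I G ξ) := by
  ext w
  exact congrArg μ (bracket_eq_divisionBracket I (G := G) ξ w)

theorem eulerPoincareEquations_iff [FiniteDimensional ℝ E] :
    EulerPoincareEquations I (reducedLagrangian I L) a b (reducedVelocity I a b g) ↔
    ∀ t ∈ Icc a b, HasDerivWithinAt
      (fun τ => fderiv ℝ (modelLagrangian L) (modelVelocity I a b g τ))
      (-(fderiv ℝ (modelLagrangian L) (modelVelocity I a b g t)).comp
        (modelBracket I G (modelVelocity I a b g t))) (Icc a b) t := by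
  simp only [← coadjointOp_eq (I := I) (G := G)]
  exact Iff.rfl

/-- One derivative is lost from the C² curve g, by the regularity half of the Maurer–Cartan lemma.
-/
theorem contDiffOn_modelVelocity (hab : a < b) (hg : ContMDiffOn 𝓘(ℝ, ℝ) I 2 g (Icc a b)) :
    ContDiffOn ℝ 1 (modelVelocity I a b g) (Icc a b) := by
  have h : ContDiffOn ℝ 1 (fun t => rightLogDeriv I g (Icc a b) t 1) (Icc a b) := fun t ht =>
    ((maurerCartan_rightLogDeriv I (uniqueDiffOn_Icc hab) ht
      (by rwa [interior_Icc, closure_Ioo hab.ne]) (hg t ht)).1).clm_apply contDiffWithinAt_const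
  exact h.congr fun t ht => reducedVelocity_eq_rightLogDeriv I hab ht (hg t ht)

/-- In any chart, the Euler–Lagrange equation at time `t` is the Euler–Poincaré equation. -/
theorem eulerLagrange_chart_iff (hL : ContMDiff I.tangent 𝓘(ℝ, ℝ) ∞ L)
    (hinv : IsRightInvariant I L) (hab : a < b) (hg : ContMDiffOn 𝓘(ℝ, ℝ) I 2 g (Icc a b))
    {e : OpenPartialHomeomorph G H} (he : e ∈ IsManifold.maximalAtlas I ∞ G) {t : ℝ}
    (ht : t ∈ Icc a b) (hgt : g t ∈ e.source) :
    (HasDerivWithinAt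
      (fun τ => fderiv ℝ (fun v => localLagrangian I L e (e.extend I (g τ)) v)
        (derivWithin (fun τ => e.extend I (g τ)) (Icc a b) τ))
      (fderiv ℝ (fun x => localLagrangian I L e x
        (derivWithin (fun τ => e.extend I (g τ)) (Icc a b) t)) (e.extend I (g t)))
      (Icc a b) t) ↔
    HasDerivWithinAt
      (fun τ => fderiv ℝ (modelLagrangian L) (modelVelocity I a b g τ))
      (-(fderiv ℝ (modelLagrangian L) (modelVelocity I a b g t)).comp
        (modelBracket I G (modelVelocity I a b g t))) (Icc a b) t := by
  set S := Icc a b with hSdef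
  have hS : UniqueDiffOn ℝ S := uniqueDiffOn_Icc hab
  set q : ℝ → E := fun τ => e.extend I (g τ) with hq
  have hsrc : ∀ᶠ τ in 𝓝[S] t, g τ ∈ e.source :=
    (hg t ht).continuousWithinAt.eventually (e.open_source.mem_nhds hgt)
  have htarget : ∀ τ, g τ ∈ e.source → q τ ∈ (e.extend I).target := fun τ hτ =>
    (e.extend I).map_source (by rwa [e.extend_source])
  have hinvq : ∀ τ, g τ ∈ e.source → (e.extend I).symm (q τ) = g τ := fun τ hτ =>
    (e.extend I).left_inv (by rwa [e.extend_source])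
  have hqs : ∀ τ ∈ S, g τ ∈ e.source → ContDiffWithinAt ℝ 2 q S τ := fun τ hτ hτe => by
    rw [← contMDiffWithinAt_iff_contDiffWithinAt]
    exact ((e.contMDiffAt_extend he hτe).of_le two_le_infty).comp_contMDiffWithinAt τ (hg τ hτ)
  have hqd : ∀ τ ∈ S, g τ ∈ e.source → HasDerivWithinAt q (derivWithin q S τ) S τ :=
    fun τ hτ hτe => ((hqs τ hτ hτe).differentiableWithinAt (by simp)).hasDerivWithinAt
  have hq'' : DifferentiableWithinAt ℝ (derivWithin q S) S t :=
    (((hqs t ht hgt).fderivWithin_right hS (m := 1) (by norm_num) ht).clm_apply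
      contDiffWithinAt_const).differentiableWithinAt (by simp)
  have hA : ∀ x ∈ (e.extend I).target, ContMDiffWithinAt 𝓘(ℝ, E) I 2 (e.extend I).symm univ x :=
    fun x hx => ((contMDiffAt_extend_symm I he hx).of_le two_le_infty).contMDiffWithinAt
  obtain ⟨hA1, hMC⟩ := maurerCartan_rightLogDeriv I uniqueDiffOn_univ (mem_univ (q t))
    (by simp) (hA _ (htarget t hgt))
  refine hasDerivWithinAt_fderiv_iff (contDiff_modelLagrangian hL)
    (A := rightLogDeriv I (e.extend I).symm univ)
    (B := fun v w => modelBracket I G v w) ht (hS t ht) (hqd t ht hgt) hq''.hasDerivWithinAt ?_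
    ((contDiffWithinAt_univ.1 hA1).differentiableAt (by simp)) ?_
    (surjective_rightLogDeriv_extend_symm I he (htarget t hgt)) ?_ fun w => rfl
  · filter_upwards [e.isOpen_extend_target.mem_nhds (htarget t hgt)] with x hx v
    exact localLagrangian_eq I hinv he hx v
  · intro v w
    rw [← fderivWithin_univ]
    exact hMC v w
  -- Near t the curve is the inverse chart applied to q, so the chain rule gives ξ = A(q) q̇.
  · filter_upwards [hsrc, eventually_eventually_nhdsWithin.2 hsrc, self_mem_nhdsWithin]
      with τ h1 h2 h3
    have h4 : g =ᶠ[𝓝[S] τ] fun τ => (e.extend I).symm (q τ) :=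
      h2.mono fun z hz => (hinvq z hz).symm
    rw [modelVelocity, reducedVelocity_eq_rightLogDeriv I hab h3 (hg τ h3),
      rightLogDeriv_congr I h4 (hinvq τ h1).symm,
      rightLogDeriv_comp I (hA _ (htarget τ h1)) (hqd τ h3 h1).hasFDerivWithinAt (hS τ h3)
        (mapsTo_univ _ _)]
    simp

/-- The Euler–Poincaré equation mentions no chart: the preferred chart at `g t` suffices to derive
it, and it returns the equation in every chart. -/
theorem eulerLagrange_iff_eulerPoincareEquations [FiniteDimensional ℝ E]
    (hL : ContMDiff I.tangent 𝓘(ℝ, ℝ) ∞ L) (hinv : IsRightInvariant I L) (hab : a < b)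
    (hg : ContMDiffOn 𝓘(ℝ, ℝ) I 2 g (Icc a b)) :
    EulerLagrange I L a b g ↔
      EulerPoincareEquations I (reducedLagrangian I L) a b (reducedVelocity I a b g) := by
  rw [eulerPoincareEquations_iff]
  constructor
  · intro h t ht
    exact (eulerLagrange_chart_iff hL hinv hab hg (IsManifold.chart_mem_maximalAtlas (g t)) ht
      (mem_chart_source H (g t))).1
      (h _ (IsManifold.chart_mem_maximalAtlas (g t)) t ht (mem_chart_source H (g t)))
  · intro h e he t ht hgt
    exact (eulerLagrange_chart_iff hL hinv hab hg he ht hgt).2 (h t ht)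

/-- The derivative of the reduced action along a constrained variation. -/
theorem IsConstrainedVariation.hasDerivAt (hL : ContMDiff I.tangent 𝓘(ℝ, ℝ) ∞ L) (hab : a < b)
    {ε : ℝ} (hε : 0 < ε) {ξ η : ℝ → E} {Ξ : ℝ → ℝ → E}
    (h : IsConstrainedVariation I (G := G) a b ξ η ε Ξ) :
    HasDerivAt (fun s => ∫ t in a..b, modelLagrangian L (Ξ t s))
      (∫ t in a..b, fderiv ℝ (modelLagrangian L) (ξ t)
        (derivWithin η (Icc a b) t - modelBracket I G (ξ t) (η t))) 0 := by
  refine (hasDerivAt_integral_comp ((contDiff_modelLagrangian hL).of_le (by norm_num)) hab.le hε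
    h.continuousOn h.differentiableAt h.continuousOn_deriv).congr_deriv ?_
  refine intervalIntegral.integral_congr fun t ht => ?_
  rw [uIcc_of_le hab.le] at ht
  have h1 : Ξ t 0 = ξ t := h.at_zero t ht
  have h2 : deriv (Ξ t) 0 = derivWithin η (Icc a b) t - modelBracket I G (ξ t) (η t) :=
    (h.variation t ht).trans (congrArg (fun z : E => derivWithin η (Icc a b) t - z)
      (bracket_eq_divisionBracket I (G := G) (ξ t) (η t)))
  simp only [h1, h2]

theorem EulerPoincareEquations.reducedPrinciple [FiniteDimensional ℝ E]
    (hL : ContMDiff I.tangent 𝓘(ℝ, ℝ) ∞ L) (hab : a < b)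
    (hg : ContMDiffOn 𝓘(ℝ, ℝ) I 2 g (Icc a b))
    (h : EulerPoincareEquations I (reducedLagrangian I L) a b (reducedVelocity I a b g)) :
    ReducedPrinciple I (reducedLagrangian I L) a b (reducedVelocity I a b g) := by
  intro η hη hη' ha hb ε hε Ξ hΞ
  rw [eulerPoincareEquations_iff] at h
  have h1 := IsConstrainedVariation.hasDerivAt (L := L) hL hab hε
    (ξ := modelVelocity I a b g) (η := η) (Ξ := Ξ) hΞ
  exact h1.congr_deriv (integral_eq_zero_of_hasDerivWithinAt hab.le
    (contDiffOn_modelVelocity hab hg).continuousOn h hη hη' ha hb)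

theorem ReducedPrinciple.hamiltonPrinciple (hinv : IsRightInvariant I L) (hab : a < b)
    (hg : ContMDiffOn 𝓘(ℝ, ℝ) I 2 g (Icc a b))
    (h : ReducedPrinciple I (reducedLagrangian I L) a b (reducedVelocity I a b g)) :
    HamiltonPrinciple I L a b g := by
  intro ε hε c hc
  simp only [hinv.action_eq]
  exact h (variationField (E := E) I a b ε c)
    (fun t ht => (hc.hasDerivWithinAt_variationField hab hε ht).differentiableWithinAt)
    (hc.continuousOn_derivWithin_variationField hab hε)
    (hc.variationField_eq_zero hε (left_mem_Icc.2 hab.le) hc.left_endpoint)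
    (hc.variationField_eq_zero hε (right_mem_Icc.2 hab.le) hc.right_endpoint) ε hε _
    (hc.isConstrainedVariation hab hε hg)

theorem HamiltonPrinciple.eulerPoincareEquations [FiniteDimensional ℝ E]
    (hL : ContMDiff I.tangent 𝓘(ℝ, ℝ) ∞ L) (hinv : IsRightInvariant I L) (hab : a < b)
    (hg : ContMDiffOn 𝓘(ℝ, ℝ) I 2 g (Icc a b)) (h : HamiltonPrinciple I L a b g) :
    EulerPoincareEquations I (reducedLagrangian I L) a b (reducedVelocity I a b g) := by
  have hξ := contDiffOn_modelVelocity hab hg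
  have hμ : ContDiffOn ℝ 1 (fun t => fderiv ℝ (modelLagrangian L) (modelVelocity I a b g t))
      (Icc a b) :=
    ((contDiff_modelLagrangian hL).fderiv_right (m := 1) (by norm_num)).comp_contDiffOn hξ
  have hμd : ∀ t ∈ Icc a b, HasDerivWithinAt
      (fun t => fderiv ℝ (modelLagrangian L) (modelVelocity I a b g t)) _ (Icc a b) t :=
    fun t ht => (hμ.differentiableOn (by simp) t ht).hasDerivWithinAt
  -- The momentum is C¹ by regularity of g and L alone; the fundamental lemma then identifies its
  -- derivative.
  have key := eq_of_integral_eq_zero (B := modelBracket I G) hab hξ.continuousOn hμd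
    (hμ.continuousOn_derivWithin (uniqueDiffOn_Icc hab) le_rfl) ?_
  · rw [eulerPoincareEquations_iff]
    intro t ht
    rw [← key t ht]
    exact hμd t ht
  intro η hη _ hηs
  have hz : ∀ t ∉ Ioo a b, η t = 0 := fun t ht =>
    image_eq_zero_of_notMem_tsupport fun h' => ht (hηs h')
  obtain ⟨ε, hε, c, hc, hcη⟩ := exists_isDeformation hab hg hη (hz a (by simp)) (hz b (by simp))
  have h1 := h ε hε c hc
  simp only [hinv.action_eq] at h1
  have h2 := IsConstrainedVariation.hasDerivAt (L := L) hL hab hε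
    (ξ := modelVelocity I a b g) (η := variationField I a b ε c)
    (Ξ := fun t s => modelVelocity I a b (fun t => c t s) t)
    (hc.isConstrainedVariation hab hε hg)
  rw [← h2.unique h1]
  refine intervalIntegral.integral_congr fun t ht => ?_
  rw [uIcc_of_le hab.le] at ht
  -- The variation field is known to equal η only on [a, b], hence the derivative within the
  -- interval.
  have h3 : derivWithin (variationField I a b ε c) (Icc a b) t = deriv η t := by
    rw [derivWithin_congr hcη (hcη t ht),
      ((hη.differentiable (by simp) t).derivWithin (uniqueDiffOn_Icc hab t ht))]
  simp only [h3, hcη t ht]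

end Equivalences

end EulerPoincare

end

theorem mainTheorem1
    {E : Type*} [NormedAddCommGroup E] [NormedSpace ℝ E] [FiniteDimensional ℝ E]
    {H : Type*} [TopologicalSpace H] (I : ModelWithCorners ℝ E H) [I.Boundaryless]
    {G : Type*} [TopologicalSpace G] [ChartedSpace H G] [Group G] [LieGroup I ∞ G]
    (L : TangentBundle I G → ℝ) (hL : ContMDiff I.tangent 𝓘(ℝ, ℝ) ∞ L)
    (hinv : EulerPoincare.IsRightInvariant I L)
    (a b : ℝ) (hab : a < b)
    (g : ℝ → G) (hg : ContMDiffOn 𝓘(ℝ, ℝ) I 2 g (Set.Icc a b)) :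
    List.TFAE [
      EulerPoincare.EulerLagrange I L a b g,
      EulerPoincare.HamiltonPrinciple I L a b g,
      EulerPoincare.EulerPoincareEquations I (EulerPoincare.reducedLagrangian I L) a b
        (EulerPoincare.reducedVelocity I a b g),
      EulerPoincare.ReducedPrinciple I (EulerPoincare.reducedLagrangian I L) a b
        (EulerPoincare.reducedVelocity I a b g)] := by
  tfae_have 1 ↔ 3 := EulerPoincare.eulerLagrange_iff_eulerPoincareEquations hL hinv hab hg
  tfae_have 3 → 4 := EulerPoincare.EulerPoincareEquations.reducedPrinciple hL hab hg
  tfae_have 4 → 2 := EulerPoincare.ReducedPrinciple.hamiltonPrinciple hinv hab hg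
  tfae_have 2 → 3 := EulerPoincare.HamiltonPrinciple.eulerPoincareEquations hL hinv hab hg
  tfae_finish
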